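/- Let $K$ be any field (possibly finite, of any characteristic) and let $(B,\tau)$ be a degree-$n$ central simple algebra with involution over $K$. That is, $B$ is a finite-dimensional associative unital $K$-algebra, $\tau:B\to B$ is $K$-linear with $\tau(xy)=\tau(y)\tau(x)$ and $\tau(\tau(x))=x$ for all $x,y\in B$, and one of the following holds: (1) (first kind) $B$ is simple with center $K$, and $\dim_K B=n^2$; or (2) (unitary) the center $Z$ of $B$ is a quadratic étale $K$-algebra, $B$ is simple or a product of two simple $K$-algebras, $\tau$ restricts to the nontrivial $K$-automorphism of $Z$, and $\dim_K B=2n^2$. An involution of the first kind is called symplectic if, for every field extension $L/K$, every finite-dimensional $L$-vector space $V$, every nondegenerate bilinear form $b$ on $V$ and every isomorphism $(B\otimes_K L,\tau\otimes\mathrm{id}_L)\cong(\mathrm{End}_L(V),\sigma_b)$ of $L$-algebras with involution, where $\sigma_b$ is the adjoint involution of $b$, the form $b$ is alternating. It is called orthogonal otherwise. A subset $S\subseteq B$ generates $(B,\tau)$ if no proper unital $K$-subalgebra of $B$ that is stable under $\tau$ contains $S$. Let $\mathrm{gen}_K(B,\tau)$ denote the smallest cardinality of a subset of $B$ that generates $(B,\tau)$.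 Then $\mathrm{gen}_K(B,\tau)=1$, unless $n=2$ and $\tau$ is symplectic, in which case $\mathrm{gen}_K(B,\tau)=2$, or $n=1$ and $\tau$ is orthogonal, in which case $\mathrm{gen}_K(B,\tau)=0$. -/

import Mathlib

open scoped TensorProduct

universe u v

namespace AlgInv

section Involutions

variable {K : Type u} [Field K] {B : Type v} [Ring B] [Algebra K B]

/-- A `K`-linear involution of the `K`-algebra `B`: an anti-multiplicative map of order dividing `2`.
(That `τ 1 = 1` follows.) -/
structure IsInvolution (τ : B →ₗ[K] B) : Prop where
  map_mul : ∀ x y : B, τ (x * y) = τ y * τ x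
  involutive : ∀ x : B, τ (τ x) = x

/-- `(B, τ)` is a central simple `K`-algebra with an involution of the first kind: `B` is
finite-dimensional, simple with center `K`, and `τ` is `K`-linear. -/
structure IsFirstKind (τ : B →ₗ[K] B) : Prop where
  finiteDimensional : FiniteDimensional K B
  central : Algebra.IsCentral K B
  simple : IsSimpleRing B
  involution : IsInvolution τ

/-- `(B, τ)` is a central simple `K`-algebra with a unitary involution (an involution of the second
kind): `B` is finite-dimensional, its center is a quadratic étale `K`-algebra, `B` is simple or a
product of two simple algebras, and `τ` restricts to a nontrivial automorphism of the center. -/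
structure IsUnitary (τ : B →ₗ[K] B) : Prop where
  finiteDimensional : FiniteDimensional K B
  etale_center : Algebra.Etale K (Subalgebra.center K B)
  finrank_center : Module.finrank K (Subalgebra.center K B) = 2
  simple_or_prod : IsSimpleRing B ∨
    ∃ (B₁ B₂ : Type v) (_ : Ring B₁) (_ : Ring B₂) (_ : Algebra K B₁) (_ : Algebra K B₂),
      IsSimpleRing B₁ ∧ IsSimpleRing B₂ ∧ Nonempty (B ≃ₐ[K] B₁ × B₂)
  involution : IsInvolution τ
  nontrivial_on_center : ∃ z ∈ Subalgebra.center K B, τ z ≠ z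

/-- `(B, τ)` is a central simple algebra with involution over `K`. -/
def IsCentralSimple (τ : B →ₗ[K] B) : Prop :=
  IsFirstKind τ ∨ IsUnitary τ

variable (K B) in
/-- `B` has degree `n`: it has rank `n ^ 2` over its center. Thus `dim B = n ^ 2` for involutions of
the first kind, and `dim B = 2 * n ^ 2` for unitary involutions. -/
def HasDegree (n : ℕ) : Prop :=
  Module.finrank K B = Module.finrank K (Subalgebra.center K B) * n ^ 2

/-- A bilinear form `b` on `V` such that `φ` is an isomorphism from `(B, τ)`, after extending
scalars to `L`, to `End_L V` with the adjoint involution of `b`. -/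
def IsAdjointTo (τ : B →ₗ[K] B) {L : Type u} [Field L] [Algebra K L]
    {V : Type u} [AddCommGroup V] [Module L V]
    (φ : L ⊗[K] B ≃ₐ[L] Module.End L V) (b : LinearMap.BilinForm L V) : Prop :=
  b.Nondegenerate ∧
    ∀ (x : L ⊗[K] B) (v w : V), b (φ (τ.baseChange L x) v) w = b v (φ x w)

/-- `τ` is symplectic: it is of the first kind, and whenever `L` is a splitting field of `B` and
`(B_L, τ_L)` is identified with `End_L V` carrying the adjoint involution of a nondegenerate
bilinear form `b` on `V`, the form `b` is alternating. -/
def IsSymplectic (τ : B →ₗ[K] B) : Prop :=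
  IsFirstKind τ ∧
    ∀ (L : Type u) [Field L] [Algebra K L]
      (V : Type u) [AddCommGroup V] [Module L V] [FiniteDimensional L V]
      (φ : L ⊗[K] B ≃ₐ[L] Module.End L V) (b : LinearMap.BilinForm L V),
      IsAdjointTo τ φ b → b.IsAlt

/-- `τ` is orthogonal: it is of the first kind and not symplectic. -/
def IsOrthogonal (τ : B →ₗ[K] B) : Prop :=
  IsFirstKind τ ∧ ¬ IsSymplectic τ

/-- `S` generates `(B, τ)`: the only (unital) `K`-subalgebra of `B` that contains `S` and is stable
under `τ` is `B` itself. -/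
def Generates (τ : B →ₗ[K] B) (S : Set B) : Prop :=
  ∀ A : Subalgebra K B, S ⊆ A → (∀ x ∈ A, τ x ∈ A) → A = ⊤

/-- The smallest cardinality of a generating subset of `(B, τ)` (`⊤` if there is no finite one). -/
noncomputable def gen (τ : B →ₗ[K] B) : ℕ∞ :=
  ⨅ (S : Set B) (_ : Generates τ S), S.encard

end Involutions

end AlgInv

/-! The core case is `End V` with `dim V = n`. Let `x` be the shift along a basis: its kernel is the
line of `b 0`, and `x ^ (n - 1)` has rank one. If `y` is nilpotent with `(y ^ (n - 1)) (b 0) ≠ 0`,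
then `x` and `y` generate `End V`: a nonzero stable subspace contains `b 0`, whereas `y ^ (n - 1)`
kills every proper stable subspace, so the action is irreducible, and an irreducible algebra with a
rank-one element is everything. Now take `y = σ x`. If `σ (φ.smulRight g) g ≠ 0` for some rank-one
map, a basis starting at `g` works. Otherwise `σ` is alternating; a variant using two basis vectors
works in dimension at least 3, and in dimension 2 `σ` is `X ↦ tr X - X`
(`exists_isNilpotent_generator`, `canonical_of_finrank_eq_two`).

Central simple algebras over finite fields are split. Over infinite fields, generation is the
nonvanishing of some polynomial in the coordinates of the generators, so it may be tested after a
scalar extension (`exists_generates_range_of_baseChange`).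

A unitary involution with split center is an exchange involution, generated by a pair (nilpotent,
unipotent), whose powers separate the factors. If the center is a field `Z`, then for infinite `K`
the algebra is a form of an exchange involution over `Z`; for finite `K` a generator is `a + N` with
`a` in `Z` moved by `τ` and `N` nilpotent, split apart by Frobenius.

In degree 2, symplectic means that all `x + τ x` and `τ x * x` are scalars (`IsCanonical`). Then
`K[x]` is `τ`-stable and commutative, so one element never suffices. -/

namespace AlgInv

/-! ### Generating `End V` by two nilpotent endomorphisms -/

section Shift

variable {F : Type*} [Field F] {V : Type*} [AddCommGroup V] [Module F V] {n : ℕ}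

/-- The nilpotent endomorphism sending each vector of a basis to the preceding one. -/
noncomputable def shift (b : Module.Basis (Fin n) F V) : Module.End F V :=
  b.constr F fun i ↦ if h : 1 ≤ (i : ℕ) then b ⟨i - 1, by omega⟩ else 0

theorem shift_pow_apply (b : Module.Basis (Fin n) F V) (k : ℕ) (i : Fin n) :
    (shift b ^ k) (b i) = if h : k ≤ (i : ℕ) then b ⟨i - k, by omega⟩ else 0 := by
  induction k generalizing i with
  | zero => simp
  | succ k ih =>
    rw [pow_succ, Module.End.mul_apply, shift, Module.Basis.constr_basis, ← shift]
    by_cases h : 1 ≤ (i : ℕ)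
    · rw [dif_pos h, ih]
      by_cases hk : k + 1 ≤ (i : ℕ)
      · rw [dif_pos (by simp; omega), dif_pos hk]
        congr 2
        simp; omega
      · rw [dif_neg (by simp; omega), dif_neg hk]
    · rw [dif_neg h, dif_neg (by omega), map_zero]

theorem shift_pow_eq_zero (b : Module.Basis (Fin n) F V) : shift b ^ n = 0 :=
  b.ext fun i ↦ by rw [shift_pow_apply, dif_neg (by omega)]; rfl

theorem shift_pow_pred_apply [NeZero n] (b : Module.Basis (Fin n) F V) (v : V) :
    (shift b ^ (n - 1)) v = b.coord ⊤ v • b 0 := by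
  have hn := NeZero.pos n
  have : shift b ^ (n - 1) = (b.coord ⊤).smulRight (b 0) := by
    refine b.ext fun i ↦ ?_
    rw [shift_pow_apply, LinearMap.smulRight_apply, Module.Basis.coord_apply,
      Module.Basis.repr_self]
    have ht : ((⊤ : Fin n) : ℕ) = n - 1 := by
      obtain ⟨m, rfl⟩ : ∃ m, n = m + 1 := ⟨n - 1, by omega⟩
      simp [Fin.top_eq_last]
    by_cases h : n - 1 ≤ (i : ℕ)
    · have : i = ⊤ := Fin.ext (by omega)
      subst this
      rw [dif_pos h, Finsupp.single_eq_same, one_smul]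
      congr 1
      exact Fin.ext (by simp [ht])
    · rw [dif_neg h, Finsupp.single_eq_of_ne, zero_smul]
      rintro h'
      rw [← h'] at h
      omega
  rw [this, LinearMap.smulRight_apply]

theorem mem_span_of_shift_apply_eq_zero [NeZero n] (b : Module.Basis (Fin n) F V) {v : V}
    (hv : shift b v = 0) : ∃ c : F, v = c • b 0 := by
  have key : ∀ (i : Fin n) (hi : (i : ℕ) + 1 < n), b.coord i (shift b v) = b.coord ⟨i + 1, hi⟩ v := by
    intro i hi
    suffices b.coord i ∘ₗ shift b = b.coord ⟨i + 1, hi⟩ from congr($this v)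
    refine b.ext fun j ↦ ?_
    have := shift_pow_apply b 1 j
    rw [pow_one] at this
    rw [LinearMap.comp_apply, this]
    by_cases h : 1 ≤ (j : ℕ)
    · rw [dif_pos h]
      simp only [Module.Basis.coord_apply, Module.Basis.repr_self, Finsupp.single_apply,
        Fin.ext_iff]
      congr 1
      exact propext (by omega)
    · rw [dif_neg h, map_zero]
      simp only [Module.Basis.coord_apply, Module.Basis.repr_self, Finsupp.single_apply,
        Fin.ext_iff]
      rw [if_neg (by omega)]
  refine ⟨b.coord 0 v, ?_⟩
  apply b.ext_elem
  intro i
  by_cases hi : i = 0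
  · subst hi; simp
  · have hi' : (i : ℕ) ≠ 0 := fun h ↦ hi (Fin.ext (by simpa using h))
    have := key ⟨i - 1, by omega⟩ (by simp; omega)
    rw [hv, map_zero] at this
    have e : (⟨(i : ℕ) - 1 + 1, by omega⟩ : Fin n) = i := Fin.ext (by simp; omega)
    simp only [e, Module.Basis.coord_apply] at this
    rw [← this]
    simp [Ne.symm hi]

/-- A nilpotent endomorphism `y` of an `n`-dimensional space kills each proper stable subspace when
raised to the power `n - 1`. -/
theorem pow_pred_apply_eq_zero_of_stable [FiniteDimensional F V] {y : Module.End F V}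
    (hy : IsNilpotent y) {W : Submodule F V} (hW : W ≠ ⊤) (hyW : ∀ w ∈ W, y w ∈ W) {w : V}
    (hw : w ∈ W) : (y ^ (Module.finrank F V - 1)) w = 0 := by
  have hlt : Module.finrank F W < Module.finrank F V := Submodule.finrank_lt hW
  have hnil : IsNilpotent (y.restrict hyW) := Module.End.isNilpotent.restrict hyW hy
  -- The nilpotency index on `W` is at most `dim W`, hence at most `dim V - 1`.
  have h0 : (y.restrict hyW) ^ Module.finrank F W = 0 := by
    obtain ⟨k, hk⟩ := hnil
    exact LinearMap.ext fun z ↦ by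
      have : z ∈ LinearMap.ker ((y.restrict hyW) ^ k) := by simp [hk]
      have := Module.End.ker_pow_le_ker_pow_finrank (y.restrict hyW) k this
      simpa using this
  have h1 : (y.restrict hyW) ^ (Module.finrank F V - 1) = 0 :=
    pow_eq_zero_of_le (by omega) h0
  have := congr(($h1 ⟨w, hw⟩ : V))
  rwa [Module.End.pow_restrict, LinearMap.coe_restrict_apply] at this

/-- A subalgebra of `End V` that acts irreducibly and contains an endomorphism of rank one is
`End V`. -/
theorem eq_top_of_irreducible_of_smulRight_mem [FiniteDimensional F V]
    (A : Subalgebra F (Module.End F V))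
    (hA : ∀ W : Submodule F V, (∀ a ∈ A, ∀ w ∈ W, a w ∈ W) → W = ⊥ ∨ W = ⊤)
    {g : V} {φ : Module.Dual F V} (hg : g ≠ 0) (hφ : φ ≠ 0) (hu : φ.smulRight g ∈ A) : A = ⊤ := by
  -- For fixed `ψ`, the vectors `v` with `ψ.smulRight v ∈ A` form an `A`-stable subspace containing
  -- `g`.
  have hcol : ∀ ψ : Module.Dual F V, ψ.smulRight g ∈ A → ∀ v : V, ψ.smulRight v ∈ A := by
    intro ψ hψ v
    let W : Submodule F V := (Subalgebra.toSubmodule A).comap (LinearMap.smulRightₗ ψ)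
    have hW : ∀ w, w ∈ W ↔ ψ.smulRight w ∈ A := fun w ↦ Iff.rfl
    rcases hA W (fun a ha w hw ↦ by
      rw [hW] at hw ⊢
      convert A.mul_mem ha hw using 1
      ext z; simp) with h | h
    · exact absurd ((Submodule.mem_bot F).1 (h ▸ (hW g).2 hψ)) hg
    · exact (hW v).1 (h ▸ Submodule.mem_top)
  let S : Submodule F (Module.Dual F V) :=
    (Subalgebra.toSubmodule A).comap (LinearMap.smulRightₗ.flip g)
  have hS : ∀ ψ, ψ ∈ S ↔ ψ.smulRight g ∈ A := fun ψ ↦ Iff.rfl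
  have hStop : S = ⊤ := by
    -- `S` is stable under precomposition with `A`, so its common kernel is `A`-stable; it is not
    -- `V` because `φ ∈ S` is nonzero.
    have : S.dualCoannihilator = ⊥ := by
      refine (hA S.dualCoannihilator fun a ha w hw ↦ ?_).resolve_right fun h ↦ hφ ?_
      · rw [Submodule.mem_dualCoannihilator] at hw ⊢
        intro ψ hψ
        refine hw (ψ ∘ₗ a) ?_
        rw [hS] at hψ ⊢
        convert A.mul_mem hψ ha using 1
        rfl
      · ext v
        have hv : v ∈ S.dualCoannihilator := h ▸ Submodule.mem_top
        exact (Submodule.mem_dualCoannihilator _).1 hv φ hu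
    rw [← Subspace.dualCoannihilator_dualAnnihilator_eq (W := S), this,
      Submodule.dualAnnihilator_bot]
  have hall : ∀ (ψ : Module.Dual F V) (v : V), ψ.smulRight v ∈ A := fun ψ v ↦
    hcol ψ ((hS ψ).1 (hStop ▸ Submodule.mem_top)) v
  rw [eq_top_iff]
  intro a _
  let b := Module.finBasis F V
  have : a = ∑ i, (b.coord i).smulRight (a (b i)) := by
    refine b.ext fun j ↦ ?_
    simp [LinearMap.sum_apply, Finsupp.single_apply]
  rw [this]
  exact A.sum_mem fun i _ ↦ hall _ _

/-- A nilpotent endomorphism of maximal index and a nilpotent endomorphism in general position with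
respect to it generate the algebra of all endomorphisms. -/
theorem eq_top_of_shift_mem_of_isNilpotent [FiniteDimensional F V] [NeZero n]
    (b : Module.Basis (Fin n) F V) {y : Module.End F V} (hy : IsNilpotent y)
    (h : (y ^ (n - 1)) (b 0) ≠ 0 ∨
      y (b 0) ≠ 0 ∧ ∃ h1 : 1 < n, (y ^ (n - 1)) (b ⟨1, h1⟩) ≠ 0)
    (A : Subalgebra F (Module.End F V)) (hxA : shift b ∈ A) (hyA : y ∈ A) : A = ⊤ := by
  have hfr : Module.finrank F V = n := by simpa using Module.finrank_eq_card_basis b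
  refine eq_top_of_irreducible_of_smulRight_mem A (fun W hW ↦ ?_) (g := b 0) (φ := b.coord ⊤)
    (b.ne_zero 0) (fun h ↦ ?_) ?_
  · by_contra! hcon
    -- The last nonzero iterate of `w` under the shift lies in its kernel, the line of `b 0`.
    have hker : ∀ {w : V}, w ∈ W → w ≠ 0 → b 0 ∈ W := by
      intro w hw hw0
      have hex : ∃ k, (shift b ^ k) w = 0 := ⟨n, by rw [shift_pow_eq_zero]; rfl⟩
      classical
      have hpos : Nat.find hex ≠ 0 := fun h0 ↦ hw0 (by simpa [h0] using Nat.find_spec hex)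
      obtain ⟨k, hk⟩ := Nat.exists_eq_succ_of_ne_zero hpos
      have hne : (shift b ^ k) w ≠ 0 := Nat.find_min hex (by omega)
      have hz : shift b ((shift b ^ k) w) = 0 := by
        have := Nat.find_spec hex
        rwa [hk, Nat.succ_eq_add_one, pow_succ', Module.End.mul_apply] at this
      obtain ⟨c, hc⟩ := mem_span_of_shift_apply_eq_zero b hz
      have hc0 : c ≠ 0 := by rintro rfl; exact hne (by simpa using hc)
      have : (shift b ^ k) w ∈ W := hW _ (A.pow_mem hxA k) _ hw
      rw [hc] at this
      exact (W.smul_mem_iff hc0).1 this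
    obtain ⟨w, hw, hw0⟩ := W.ne_bot_iff.1 hcon.1
    have hb0 : b 0 ∈ W := hker hw hw0
    have hyW : ∀ w ∈ W, (y ^ (n - 1)) w = 0 := fun w hw ↦ by
      rw [← hfr]; exact pow_pred_apply_eq_zero_of_stable hy hcon.2 (hW y hyA) hw
    rcases h with h | ⟨h0, h1, h⟩
    · exact h (hyW _ hb0)
    · -- either `W` is the line through `b 0`, which `y` does not kill, or it contains `b 1`
      by_cases hline : ∀ w ∈ W, ∃ c : F, w = c • b 0
      · obtain ⟨c, hc⟩ := hline _ (hW y hyA _ hb0)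
        have hpow : ∀ k, (y ^ k) (b 0) = c ^ k • b 0 := by
          intro k
          induction k with
          | zero => simp
          | succ k ih => rw [pow_succ', Module.End.mul_apply, ih, map_smul, hc, smul_smul, pow_succ]
        obtain ⟨k, hk⟩ := hy
        have := hpow k
        rw [hk, LinearMap.zero_apply, eq_comm, smul_eq_zero, or_iff_left (b.ne_zero 0)] at this
        exact h0 (by rw [hc, eq_zero_of_pow_eq_zero this, zero_smul])
      · push Not at hline
        obtain ⟨w, hw, hwne⟩ := hline
        have hex : ∃ k, (shift b ^ k) w = 0 := ⟨n, by rw [shift_pow_eq_zero]; rfl⟩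
        classical
        have hw1 : shift b w ≠ 0 := fun h ↦ by
          obtain ⟨c, hc⟩ := mem_span_of_shift_apply_eq_zero b h
          exact hwne c hc
        -- Since `w` is off the line of `b 0`, its orbit has a penultimate nonzero iterate; this is
        -- a combination of `b 0` and `b 1` with nonzero coefficient at `b 1`.
        have hpos : 2 ≤ Nat.find hex := by
          rw [Nat.le_find_iff]
          intro m hm
          interval_cases m
          · simpa using fun h ↦ hw1 (by rw [h, map_zero])
          · simpa using hw1
        obtain ⟨k, hk⟩ := Nat.exists_eq_add_of_le' hpos
        have hne : (shift b ^ (k + 1)) w ≠ 0 := Nat.find_min hex (by omega)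
        have hz : shift b (shift b ((shift b ^ k) w)) = 0 := by
          have := Nat.find_spec hex
          rwa [hk, pow_succ', pow_succ', Module.End.mul_apply, Module.End.mul_apply] at this
        obtain ⟨c, hc⟩ := mem_span_of_shift_apply_eq_zero b hz
        have hc0 : c ≠ 0 := by
          rintro rfl
          exact hne (by rw [pow_succ', Module.End.mul_apply, hc, zero_smul])
        have hb1 : shift b (b ⟨1, h1⟩) = b 0 := by
          have := shift_pow_apply b 1 ⟨1, h1⟩
          rw [pow_one, dif_pos le_rfl] at this
          exact this
        obtain ⟨d, hd⟩ := mem_span_of_shift_apply_eq_zero b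
          (v := (shift b ^ k) w - c • b ⟨1, h1⟩) (by rw [map_sub, hc, map_smul, hb1, sub_self])
        have hmem : c • b ⟨1, h1⟩ ∈ W := by
          have : c • b ⟨1, h1⟩ = (shift b ^ k) w - d • b 0 := by rw [← hd]; abel
          rw [this]
          exact W.sub_mem (hW _ (A.pow_mem hxA k) _ hw) (W.smul_mem _ hb0)
        exact h (hyW _ ((W.smul_mem_iff hc0).1 hmem))
  · have := congr($h (b ⊤))
    simp at this
  · have : (b.coord ⊤).smulRight (b 0) = shift b ^ (n - 1) :=
      LinearMap.ext fun v ↦ by rw [shift_pow_pred_apply]; rfl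
    rw [this]
    exact A.pow_mem hxA _

end Shift

/-! ### Additive anti-involutions of rings -/

section AntiInvolution

/-- An additive, anti-multiplicative map of order dividing `2` on a ring. -/
structure IsAntiInvolution {R : Type*} [Ring R] (σ : R → R) : Prop where
  map_add : ∀ x y, σ (x + y) = σ x + σ y
  map_mul : ∀ x y, σ (x * y) = σ y * σ x
  involutive : ∀ x, σ (σ x) = x

namespace IsAntiInvolution

variable {R : Type*} [Ring R] {σ : R → R} (hσ : IsAntiInvolution σ)
include hσ

theorem map_zero : σ 0 = 0 := by
  simpa using hσ.map_add 0 0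

theorem map_one : σ 1 = 1 := by
  have h := hσ.map_mul (σ 1) 1
  rwa [mul_one, hσ.involutive, mul_one, eq_comm] at h

theorem map_pow (x : R) (k : ℕ) : σ (x ^ k) = σ x ^ k := by
  induction k with
  | zero => simpa using hσ.map_one
  | succ k ih => rw [pow_succ, hσ.map_mul, ih, pow_succ']

theorem injective : Function.Injective σ := fun x y h ↦ by
  rw [← hσ.involutive x, h, hσ.involutive]

theorem isNilpotent {x : R} (hx : IsNilpotent x) : IsNilpotent (σ x) := by
  obtain ⟨k, hk⟩ := hx
  exact ⟨k, by rw [← hσ.map_pow, hk, hσ.map_zero]⟩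

end IsAntiInvolution

end AntiInvolution

/-! ### Anti-involutions of `End V`: one generator, or the canonical involution -/

section EndGenerators

variable {F : Type*} [Field F] {V : Type*} [AddCommGroup V] [Module F V] [FiniteDimensional F V]
  {n : ℕ}

/-- A linearly independent family indexed by `Fin k` is the beginning of a basis. -/
theorem exists_basis_extending {k : ℕ} (hn : Module.finrank F V = n) {w : Fin k → V}
    (hw : LinearIndependent F w) :
    ∃ (hk : k ≤ n) (b : Module.Basis (Fin n) F V), ∀ i : Fin k, b (Fin.castLE hk i) = w i := by
  classical
  let c := Module.Basis.sumExtend hw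
  have : Finite (Fin k ⊕ Module.Basis.sumExtendIndex hw) := Module.Finite.finite_basis c
  have : Finite (Module.Basis.sumExtendIndex hw) := Finite.sum_right (Fin k)
  have : Fintype (Module.Basis.sumExtendIndex hw) := Fintype.ofFinite _
  have hcard : k + Fintype.card (Module.Basis.sumExtendIndex hw) = n := by
    rw [← hn, Module.finrank_eq_card_basis c, Fintype.card_sum, Fintype.card_fin]
  let e : Fin k ⊕ Module.Basis.sumExtendIndex hw ≃ Fin n :=
    ((Equiv.refl _).sumCongr (Fintype.equivFin _)).trans (finSumFinEquiv.trans (finCongr hcard))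
  refine ⟨by omega, c.reindex e, fun i ↦ ?_⟩
  have : e.symm (Fin.castLE (by omega) i) = Sum.inl i := by
    rw [Equiv.symm_apply_eq]
    rfl
  rw [Module.Basis.reindex_apply, this]
  simp [c, Module.Basis.sumExtend]
  rfl

variable {σ : Module.End F V → Module.End F V}

/-- If the anti-involution `σ` of `End V` is not "alternating", or if `dim V ≥ 3`, then `End V` is
generated by `x` and `σ x` for some nilpotent `x`. -/
theorem exists_isNilpotent_generator (hσ : IsAntiInvolution σ)
    (h : 3 ≤ Module.finrank F V ∨
      ∃ (g : V) (φ : Module.Dual F V), σ (φ.smulRight g) g ≠ 0) :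
    ∃ x : Module.End F V, IsNilpotent x ∧
      ∀ A : Subalgebra F (Module.End F V), x ∈ A → σ x ∈ A → A = ⊤ := by
  obtain ⟨n, hn⟩ : ∃ n, Module.finrank F V = n := ⟨_, rfl⟩
  -- rank one maps with the same image as the top power of the shift
  have factor : ∀ [NeZero n] (b : Module.Basis (Fin n) F V) (φ : Module.Dual F V) (v : V),
      σ (φ.smulRight (b 0)) v ≠ 0 → (σ (shift b) ^ (n - 1)) v ≠ 0 := by
    intro _ b φ v hv h0
    apply hv
    have : φ.smulRight (b 0) = shift b ^ (n - 1) * φ.smulRight (b ⊤) :=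
      LinearMap.ext fun z ↦ by
        rw [Module.End.mul_apply, LinearMap.smulRight_apply, LinearMap.smulRight_apply, map_smul,
          shift_pow_pred_apply]
        simp
    rw [this, hσ.map_mul, hσ.map_pow, Module.End.mul_apply, h0, _root_.map_zero]
  have nil : ∀ b : Module.Basis (Fin n) F V, IsNilpotent (shift b) := fun b ↦
    ⟨n, shift_pow_eq_zero b⟩
  by_cases h' : ∃ (g : V) (φ : Module.Dual F V), σ (φ.smulRight g) g ≠ 0
  · obtain ⟨g, φ, hg⟩ := h'
    have hg0 : g ≠ 0 := by rintro rfl; exact hg (_root_.map_zero _)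
    obtain ⟨hk, b, hb⟩ := exists_basis_extending hn (w := ![g])
      (by simpa [linearIndependent_unique_iff] using hg0)
    have : NeZero n := ⟨by omega⟩
    have hb0 : b 0 = g := hb 0
    refine ⟨shift b, nil b, fun A hx hy ↦ ?_⟩
    refine eq_top_of_shift_mem_of_isNilpotent b (hσ.isNilpotent (nil b)) (.inl ?_) A hx hy
    exact factor b φ _ (by rwa [hb0])
  · have h3 := h.resolve_right h'
    push Not at h'
    have : Nontrivial V := Module.nontrivial_of_finrank_pos (R := F) (by omega)
    obtain ⟨g, hg⟩ := exists_ne (0 : V)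
    obtain ⟨φ, hφ⟩ := Module.Projective.exists_dual_ne_zero F hg
    have hu : σ (φ.smulRight g) ≠ 0 := by
      rw [← hσ.map_zero]
      refine fun h ↦ hφ ?_
      have := congr($(hσ.injective h) g)
      simpa [hg] using this
    obtain ⟨v, hv⟩ : ∃ v, σ (φ.smulRight g) v ≠ 0 := by
      by_contra! hcon
      exact hu (LinearMap.ext hcon)
    -- In the alternating case `σ (φ.smulRight g)` kills `g` but not `v`.
    have hli : LinearIndependent F ![g, v] := by
      rw [LinearIndependent.pair_iff' hg]
      rintro a rfl
      exact hv (by rw [map_smul, h', smul_zero])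
    obtain ⟨hk, b, hb⟩ := exists_basis_extending hn hli
    have : NeZero n := ⟨by omega⟩
    have hb0 : b 0 = g := hb 0
    have h1 : 1 < n := by omega
    have hb1 : b ⟨1, h1⟩ = v := hb 1
    have hv' := factor b φ v (by rwa [hb0])
    refine ⟨shift b, nil b, fun A hx hy ↦ ?_⟩
    refine eq_top_of_shift_mem_of_isNilpotent b (hσ.isNilpotent (nil b))
      (.inr ⟨fun h0 ↦ ?_, h1, by rwa [hb1]⟩) A hx hy
    -- if `σ x` kills `b 0`, then `σ u * x = 0`, but `b 1` lies in the image of `x`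
    have hzero : σ (shift b) * shift b ^ (n - 1) = 0 := LinearMap.ext fun z ↦ by
      rw [Module.End.mul_apply, shift_pow_pred_apply, map_smul, h0, smul_zero]; rfl
    have hzero' : σ (shift b) ^ (n - 1) * shift b = 0 := by
      have := congr(σ $hzero)
      rwa [hσ.map_mul, hσ.map_pow, hσ.involutive, hσ.map_zero] at this
    -- Dimension at least 3 enters here, through the existence of `b 2`.
    have h2 : shift b (b ⟨2, by omega⟩) = v := by
      have := shift_pow_apply b 1 ⟨2, by omega⟩
      rw [pow_one, dif_pos (by simp)] at this
      rw [this, ← hb1]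
      rfl
    exact hv' (by rw [← h2, ← Module.End.mul_apply, hzero', LinearMap.zero_apply])

/-- An "alternating" anti-involution of `End V` with `dim V = 2` is the canonical involution
`X ↦ tr X - X`. -/
theorem canonical_of_finrank_eq_two (hσ : IsAntiInvolution σ) (hV : Module.finrank F V = 2)
    (h : ∀ (g : V) (φ : Module.Dual F V), σ (φ.smulRight g) g = 0) :
    (∀ c : F, σ (algebraMap F _ c) = algebraMap F _ c) ∧
      ∀ X, (∃ c : F, X + σ X = algebraMap F _ c) ∧ ∃ d : F, σ X * X = algebraMap F _ d := by
  let b : Module.Basis (Fin 2) F V := Module.finBasisOfFinrankEq F V hV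
  -- The matrix units carry a coefficient because `σ` is only additive. That it fixes scalars is a
  -- conclusion, which later excludes this case for unitary involutions.
  let E : Fin 2 → Fin 2 → F → Module.End F V := fun i j a ↦ (b.coord j).smulRight (a • b i)
  have hE : ∀ i j a k, E i j a (b k) = if j = k then a • b i else 0 := by
    intro i j a k
    simp [E, Finsupp.single_apply, eq_comm]
  have hmul : ∀ i j k a c, E i j a * E j k c = E i k (a * c) := by
    intro i j k a c
    refine b.ext fun l ↦ ?_
    rw [Module.End.mul_apply, hE, hE]
    split_ifs <;> simp [hE, smul_smul, mul_comm]
  have hone : E 0 0 1 + E 1 1 1 = 1 := by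
    refine b.ext fun l ↦ ?_
    rw [LinearMap.add_apply, hE, hE]
    fin_cases l <;> simp
  -- The images of the two diagonal idempotents sum to 1 and each kills its own basis vector, so
  -- each fixes the other one.
  have hdiag : ∀ i j : Fin 2, i ≠ j → σ (E i i 1) = E j j 1 := by
    intro i j hij
    have h1 : σ (E i i 1) (b i) = 0 := by simpa [E] using h (b i) (b.coord i)
    have h2 : σ (E j j 1) (b j) = 0 := by simpa [E] using h (b j) (b.coord j)
    have h3 : E i i 1 + E j j 1 = 1 := by
      fin_cases i <;> fin_cases j
      · simp at hij
      · exact hone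
      · rw [add_comm]; exact hone
      · simp at hij
    have h4 : σ (E i i 1) (b j) = b j := by
      have := congr($(congr(σ $h3)) (b j))
      rwa [hσ.map_add, hσ.map_one, LinearMap.add_apply, h2, add_zero] at this
    refine b.ext fun l ↦ ?_
    rw [hE]
    by_cases hl : j = l
    · subst hl; rw [if_pos rfl, h4, one_smul]
    · have : l = i := by omega
      subst this; rw [if_neg hl, h1]
  have hoff : ∀ i j : Fin 2, i ≠ j → ∀ a, σ (E i j a) = -E i j a := by
    intro i j hij a
    have h1 : σ (E i j a) (a • b i) = 0 := h (a • b i) (b.coord j)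
    -- Polarization: the argument of `σ` is again of rank one, with image spanned by `a • b i + b
    -- j`.
    have h2 : σ (E i j a + E j j 1) (a • b i + b j) = 0 := by
      have := h (a • b i + b j) (b.coord j)
      convert this using 3
      ext z; simp [E]
    have h3 : σ (E i j a) (b j) = -(a • b i) := by
      rw [hσ.map_add, hdiag j i hij.symm, LinearMap.add_apply, map_add, map_add, h1, map_smul, hE,
        hE, if_pos rfl, if_neg hij] at h2
      rw [eq_neg_iff_add_eq_zero]
      simpa using h2
    have h5 : σ (E i j a) (b i) = 0 := by
      rcases eq_or_ne a 0 with rfl | ha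
      · have : E i j 0 = 0 := by ext; simp [E]
        rw [this, hσ.map_zero]; rfl
      · rwa [map_smul, smul_eq_zero, or_iff_right ha] at h1
    refine b.ext fun l ↦ ?_
    rw [LinearMap.neg_apply, hE]
    by_cases hl : j = l
    · subst hl; rw [if_pos rfl, h3]
    · have : l = i := by omega
      subst this; rw [if_neg hl, h5, neg_zero]
  have hdiag' : ∀ i j : Fin 2, i ≠ j → ∀ a, σ (E i i a) = E j j a := by
    intro i j hij a
    have := hmul i j i a 1
    rw [mul_one] at this
    rw [← this, hσ.map_mul, hoff i j hij, hoff j i hij.symm, neg_mul_neg, hmul, one_mul]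
  have hscal : ∀ c, algebraMap F (Module.End F V) c = E 0 0 c + E 1 1 c := by
    intro c
    refine b.ext fun l ↦ ?_
    rw [LinearMap.add_apply, hE, hE]
    fin_cases l <;> simp
  have hdec : ∀ X : Module.End F V, X =
      E 0 0 (b.repr (X (b 0)) 0) + E 0 1 (b.repr (X (b 1)) 0) +
        (E 1 0 (b.repr (X (b 0)) 1) + E 1 1 (b.repr (X (b 1)) 1)) := by
    intro X
    refine b.ext fun l ↦ ?_
    simp only [LinearMap.add_apply, hE]
    fin_cases l
    · have := b.sum_repr (X (b 0))
      rw [Fin.sum_univ_two] at this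
      simpa using this.symm
    · have := b.sum_repr (X (b 1))
      rw [Fin.sum_univ_two] at this
      simpa using this.symm
  have hσX : ∀ p q r s : F, σ (E 0 0 p + E 0 1 q + (E 1 0 r + E 1 1 s)) =
      E 1 1 p - E 0 1 q + (-E 1 0 r + E 0 0 s) := by
    intro p q r s
    rw [hσ.map_add, hσ.map_add, hσ.map_add, hdiag' 0 1 (by simp), hdiag' 1 0 (by simp),
      hoff 0 1 (by simp), hoff 1 0 (by simp), sub_eq_add_neg]
  refine ⟨fun c ↦ ?_, fun X ↦ ?_⟩
  · rw [hscal, hσ.map_add, hdiag' 0 1 (by simp), hdiag' 1 0 (by simp), add_comm]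
  · rw [hdec X, hσX]
    generalize b.repr (X (b 0)) 0 = p
    generalize b.repr (X (b 1)) 0 = q
    generalize b.repr (X (b 0)) 1 = r
    generalize b.repr (X (b 1)) 1 = s
    refine ⟨⟨p + s, ?_⟩, ⟨p * s - q * r, ?_⟩⟩
    · rw [hscal]
      refine b.ext fun l ↦ ?_
      fin_cases l <;> simp [hE] <;> module
    · rw [hscal]
      refine b.ext fun l ↦ ?_
      fin_cases l <;> simp [hE] <;> module

end EndGenerators

/-! ### Exchange involutions -/

section Exchange

variable (F : Type*) [Field F] (C : Type*) [Ring C] [Algebra F C]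

/-- The exchange involution on `C × Cᵐᵒᵖ`. -/
def exchange : C × Cᵐᵒᵖ →ₗ[F] C × Cᵐᵒᵖ where
  toFun z := (z.2.unop, MulOpposite.op z.1)
  map_add' _ _ := rfl
  map_smul' _ _ := rfl

variable {F C}

@[simp]
theorem exchange_apply (z : C × Cᵐᵒᵖ) : exchange F C z = (z.2.unop, MulOpposite.op z.1) := rfl

theorem isInvolution_exchange : IsInvolution (exchange F C) where
  map_mul _ _ := rfl
  involutive _ := rfl

theorem isNilpotent_one_sub_one_add_pow {R : Type*} [Ring R] {y : R} (hy : IsNilpotent y) (k : ℕ) :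
    IsNilpotent (1 - (1 + y) ^ k) := by
  have h : (1 + y) ^ k - 1 = y * ∑ i ∈ Finset.range k, (1 + y) ^ i := by
    rw [← mul_geom_sum, add_sub_cancel_left]
  have hc : Commute y (∑ i ∈ Finset.range k, (1 + y) ^ i) :=
    Commute.sum_right _ _ _ fun i _ ↦ ((Commute.one_right y).add_right (Commute.refl y)).pow_right i
  rw [← neg_sub, h]
  exact (hc.isNilpotent_mul_right hy).neg

/-- A shift and a nilpotent endomorphism in general position with respect to it. -/
theorem exists_shift_pair {V : Type*} [AddCommGroup V] [Module F V] [FiniteDimensional F V]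
    {n : ℕ} [NeZero n] (hn : Module.finrank F V = n) :
    ∃ (b : Module.Basis (Fin n) F V) (y : Module.End F V),
      IsNilpotent y ∧ (y ^ (n - 1)) (b 0) ≠ 0 := by
  let b := Module.finBasisOfFinrankEq F V hn
  -- For the shift along the reversed basis, `b 0` is the last vector, so it survives `n - 1` steps.
  refine ⟨b, shift (b.reindex Fin.revPerm), ⟨n, shift_pow_eq_zero _⟩, ?_⟩
  have h0 : b 0 = (b.reindex Fin.revPerm) (Fin.rev 0) := by
    rw [Module.Basis.reindex_apply, Fin.revPerm_symm, Fin.revPerm_apply, Fin.rev_rev]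
  rw [h0, shift_pow_apply, dif_pos (by simp [Fin.val_rev])]
  exact Module.Basis.ne_zero _ _

/-- The generator pairs the nilpotent shift with the unipotent `1 + y`. Powers isolate the
idempotent `(1, 0)`; the first projection then contains both the shift and `y`, and the exchange map
carries the first factor to the second. -/
theorem exists_generates_exchange_end {V : Type*} [AddCommGroup V] [Module F V]
    [FiniteDimensional F V] [Nontrivial V] :
    ∃ z, Generates (exchange F (Module.End F V)) {z} := by
  obtain ⟨n, hn⟩ : ∃ n, Module.finrank F V = n := ⟨_, rfl⟩
  have hpos := Module.finrank_pos (R := F) (M := V)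
  have : NeZero n := ⟨by omega⟩
  obtain ⟨b, y, hy, hyb⟩ := exists_shift_pair (F := F) (V := V) hn
  refine ⟨(shift b, MulOpposite.op (1 + y)), fun A hA hstab ↦ ?_⟩
  rw [Set.singleton_subset_iff] at hA
  have hA' := hstab _ hA
  simp only [exchange_apply, MulOpposite.unop_op] at hA'
  -- For the generator `z`, `1 - z ^ n` has components 1 and a nilpotent, so a power of it is `(1,
  -- 0)`.
  have he : ((1, 0) : Module.End F V × (Module.End F V)ᵐᵒᵖ) ∈ A := by
    obtain ⟨k, hk⟩ := isNilpotent_one_sub_one_add_pow hy n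
    have hmem := A.pow_mem (A.sub_mem A.one_mem (A.pow_mem hA n)) k
    convert hmem using 1
    ext1
    · simp [shift_pow_eq_zero]
    · simp only [Prod.pow_snd, Prod.snd_sub, Prod.snd_one]
      rw [← MulOpposite.op_pow, ← MulOpposite.op_one, ← MulOpposite.op_sub, ← MulOpposite.op_pow, hk,
        MulOpposite.op_zero]
  have hfst : A.map (AlgHom.fst F _ _) = ⊤ := by
    refine eq_top_of_shift_mem_of_isNilpotent b hy (.inl hyb) _ ⟨_, hA, rfl⟩ ?_
    have h1 : 1 + y ∈ A.map (AlgHom.fst F _ _) := ⟨_, hA', rfl⟩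
    simpa using Subalgebra.sub_mem _ h1 (Subalgebra.one_mem _)
  have hleft : ∀ c, ((c, 0) : Module.End F V × (Module.End F V)ᵐᵒᵖ) ∈ A := by
    intro c
    obtain ⟨⟨c', d⟩, hcd, rfl⟩ : c ∈ A.map (AlgHom.fst F _ _) := hfst ▸ Algebra.mem_top
    simpa using A.mul_mem hcd he
  rw [eq_top_iff]
  rintro ⟨c, d⟩ -
  have h2 := hstab _ (hleft d.unop)
  simpa using A.add_mem (hleft c) h2

end Exchange

/-! ### Transport along isomorphisms -/

section Transport

variable {K : Type*} [Field K] {B C : Type*} [Ring B] [Algebra K B] [Ring C] [Algebra K C]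
  {τ : B →ₗ[K] B} {σ : C →ₗ[K] C}

/-- Generating sets are transported along isomorphisms of algebras with involution. -/
theorem Generates.image_symm (e : B ≃ₐ[K] C) (he : ∀ x, e (τ x) = σ (e x)) {S : Set C}
    (hS : Generates σ S) : Generates τ (e.symm '' S) := by
  intro A hA hst
  have h : A.map e.toAlgHom = ⊤ := by
    refine hS _ (fun s hs ↦ ⟨e.symm s, hA ⟨s, hs, rfl⟩, by simp⟩) ?_
    rintro _ ⟨a, ha, rfl⟩
    exact ⟨τ a, hst a ha, he a⟩
  rw [eq_top_iff]
  intro x _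
  obtain ⟨a, ha, hax⟩ : e x ∈ A.map e.toAlgHom := h ▸ Algebra.mem_top
  rwa [← e.injective hax]

end Transport

/-! ### Descent of generators over infinite fields -/

section Descent

variable {K : Type*} [Field K] {B : Type*} [Ring B] [Algebra K B] {κ ι : Type*}

theorem IsInvolution.map_one {τ : B →ₗ[K] B} (hτ : IsInvolution τ) : τ 1 = 1 := by
  have h := hτ.map_mul (τ 1) 1
  rwa [mul_one, hτ.involutive, mul_one, eq_comm] at h

theorem IsInvolution.isAntiInvolution {τ : B →ₗ[K] B} (hτ : IsInvolution τ) :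
    IsAntiInvolution τ :=
  ⟨τ.map_add, hτ.map_mul, hτ.involutive⟩

/-- The words in the elements of a family and their images under `τ`. -/
def words (τ : B → B) (x : κ → B) : Submonoid B :=
  Submonoid.closure (Set.range x ∪ Set.range (τ ∘ x))

/-- The subalgebra generated by the `x k` and `τ (x k)` is already `τ`-stable. This makes generation
a spanning condition on words, hence a determinant condition. -/
theorem generates_range_iff_span_words {τ : B →ₗ[K] B} (hτ : IsInvolution τ) (x : κ → B) :
    Generates τ (Set.range x) ↔ Submodule.span K (words τ x : Set B) = ⊤ := by
  have hadj : Submodule.span K (words τ x : Set B) =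
      Subalgebra.toSubmodule (Algebra.adjoin K (Set.range x ∪ Set.range (τ ∘ x))) :=
    (Algebra.adjoin_eq_span K _).symm
  rw [hadj, Algebra.toSubmodule_eq_top]
  refine ⟨fun h ↦ h _ (fun s hs ↦ Algebra.subset_adjoin (.inl hs)) fun z hz ↦ ?_, fun h A hA hst ↦ ?_⟩
  · induction hz using Algebra.adjoin_induction with
    | mem z hz =>
      rcases hz with ⟨k, rfl⟩ | ⟨k, rfl⟩
      · exact Algebra.subset_adjoin (.inr ⟨k, rfl⟩)
      · rw [Function.comp_apply, hτ.involutive]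
        exact Algebra.subset_adjoin (.inl ⟨k, rfl⟩)
    | algebraMap r =>
      rw [Algebra.algebraMap_eq_smul_one, map_smul, hτ.map_one]
      exact Subalgebra.smul_mem _ (Subalgebra.one_mem _) _
    | add a c _ _ ha hc => rw [map_add]; exact Subalgebra.add_mem _ ha hc
    | mul a c _ _ ha hc => rw [hτ.map_mul]; exact Subalgebra.mul_mem _ hc ha
  · rw [← top_le_iff, ← h, Algebra.adjoin_le_iff]
    rintro _ (hs | ⟨k, rfl⟩)
    · exact hA hs
    · exact hst _ (hA ⟨k, rfl⟩)

variable {R : Type*} [CommRing R] [Algebra K R]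
  {L : Type*} [Field L] [Algebra K L] {C : Type*} [Ring C] [Algebra L C] [Algebra K C]
  [IsScalarTower K L C]

/-- The homomorphism `R ⊗ B → C` induced by homomorphisms `R → L` and `B → C`. -/
noncomputable def specialize (f : R →ₐ[K] L) (j : B →ₐ[K] C) : R ⊗[K] B →ₐ[K] C :=
  Algebra.TensorProduct.lift ((IsScalarTower.toAlgHom K L C).comp f) j
    fun r x ↦ Algebra.commutes (f r) (j x)

theorem specialize_tmul (f : R →ₐ[K] L) (j : B →ₐ[K] C) (r : R) (x : B) :
    specialize f j (r ⊗ₜ x) = f r • j x := by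
  rw [Algebra.smul_def]
  exact Algebra.TensorProduct.lift_tmul _ _ _ _ _

theorem specialize_baseChange (f : R →ₐ[K] L) (j : B →ₐ[K] C) {τ : B →ₗ[K] B} {σ : C →ₗ[L] C}
    (hj : ∀ x, j (τ x) = σ (j x)) (t : R ⊗[K] B) :
    specialize f j (τ.baseChange R t) = σ (specialize f j t) := by
  induction t with
  | zero => simp
  | tmul r x => simp [specialize_tmul, hj]
  | add s t hs ht => simp [hs, ht]

theorem repr_specialize (f : R →ₐ[K] L) (j : B →ₐ[K] C) (b : Module.Basis ι K B)
    (c : Module.Basis ι L C) (hc : ∀ i, c i = j (b i)) (t : R ⊗[K] B) (i : ι) :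
    c.repr (specialize f j t) i = f ((Algebra.TensorProduct.basis R b).repr t i) := by
  induction t with
  | zero => simp
  | add s t hs ht => simp [hs, ht]
  | tmul r x =>
    have hx : c.repr (j x) i = algebraMap K L (b.repr x i) := by
      suffices (c.coord i).restrictScalars K ∘ₗ j.toLinearMap =
          Algebra.linearMap K L ∘ₗ b.coord i from congr($this x)
      classical
      refine b.ext fun k ↦ ?_
      simp [← hc, Finsupp.single_apply, apply_ite]
    simp [specialize_tmul, hx]

theorem map_words_specialize (f : R →ₐ[K] L) (j : B →ₐ[K] C) {τ : B →ₗ[K] B} {σ : C →ₗ[L] C}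
    (hj : ∀ x, j (τ x) = σ (j x)) (x : κ → R ⊗[K] B) :
    (words (τ.baseChange R) x).map (specialize f j : R ⊗[K] B →* C) =
      words σ fun k ↦ specialize f j (x k) := by
  rw [words, words, MonoidHom.map_mclosure, Set.image_union, ← Set.range_comp, ← Set.range_comp]
  congr 3
  funext k
  exact specialize_baseChange f j hj _

/-- Generators of an algebra with involution over an infinite field exist when they exist after an
extension of scalars. -/
theorem exists_generates_range_of_baseChange [Infinite K] [Finite ι] {τ : B →ₗ[K] B}
    {σ : C →ₗ[L] C} (hτ : IsInvolution τ) (hσ : IsInvolution σ) (j : B →ₐ[K] C)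
    (hj : ∀ x, j (τ x) = σ (j x)) (b : Module.Basis ι K B) (c : Module.Basis ι L C)
    (hc : ∀ i, c i = j (b i)) {x : κ → C} (hx : Generates σ (Set.range x)) :
    ∃ y : κ → B, Generates τ (Set.range y) := by
  classical
  have := Fintype.ofFinite ι
  -- The generic family, with independent variables as coordinates. Some words in `x` form a basis
  -- of `C`; the same words in `X` have a determinant that is nonzero at the coordinates of `x`,
  -- hence nonzero at some `K`-point `p`.
  let X : κ → MvPolynomial (κ × ι) K ⊗[K] B := fun k ↦ ∑ i, MvPolynomial.X (k, i) ⊗ₜ b i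
  have hspan := (generates_range_iff_span_words hσ x).1 hx
  let w' := Module.Basis.ofSpan hspan.ge
  let w : Module.Basis ι L C := w'.reindex (w'.indexEquiv c)
  have hw : ∀ i, w i ∈ words σ x := fun i ↦ by
    rw [Module.Basis.reindex_apply]
    exact Module.Basis.ofSpan_subset hspan.ge ⟨_, rfl⟩
  let f : MvPolynomial (κ × ι) K →ₐ[K] L := MvPolynomial.aeval fun p ↦ c.repr (x p.1) p.2
  have hfX : (fun k ↦ specialize f j (X k)) = x := by
    funext k
    simp only [X, map_sum, specialize_tmul, f, MvPolynomial.aeval_X, ← hc]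
    exact c.sum_repr (x k)
  have hmap := map_words_specialize f j hj X
  rw [hfX] at hmap
  have hex : ∀ i, ∃ t ∈ words (τ.baseChange (MvPolynomial (κ × ι) K)) X,
      specialize f j t = w i := fun i ↦ by
    have := hw i
    rw [← hmap] at this
    exact this
  choose W hW hWw using hex
  let M : Matrix ι ι (MvPolynomial (κ × ι) K) :=
    (Algebra.TensorProduct.basis (MvPolynomial (κ × ι) K) b).toMatrix W
  have hfM : f M.det ≠ 0 := by
    have : f.toRingHom.mapMatrix M = c.toMatrix w := by
      ext i i'
      simp only [RingHom.mapMatrix_apply, Matrix.map_apply, M, Module.Basis.toMatrix_apply, ← hWw]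
      exact (repr_specialize f j b c hc _ _).symm
    have h3 := (c.isUnit_det w).ne_zero
    rw [Module.Basis.det_apply, ← this, ← RingHom.map_det] at h3
    exact h3
  have hM : M.det ≠ 0 := fun h ↦ hfM (by rw [h, map_zero])
  obtain ⟨p, hp⟩ : ∃ p : κ × ι → K, MvPolynomial.eval p M.det ≠ 0 := by
    by_contra! hcon
    exact hM (MvPolynomial.funext fun p ↦ by rw [hcon, map_zero])
  let g : MvPolynomial (κ × ι) K →ₐ[K] K := MvPolynomial.aeval p
  refine ⟨fun k ↦ specialize g (AlgHom.id K B) (X k), ?_⟩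
  rw [generates_range_iff_span_words hτ,
    ← map_words_specialize g (AlgHom.id K B) (τ := τ) (σ := τ) (fun _ ↦ rfl) X]
  have hgM : b.det (fun i ↦ specialize g (AlgHom.id K B) (W i)) ≠ 0 := by
    rw [Module.Basis.det_apply]
    have : g.toRingHom.mapMatrix M = b.toMatrix fun i ↦ specialize g (AlgHom.id K B) (W i) := by
      ext i i'
      simp only [RingHom.mapMatrix_apply, Matrix.map_apply, M, Module.Basis.toMatrix_apply]
      exact (repr_specialize g (AlgHom.id K B) b b (fun _ ↦ rfl) _ _).symm
    rw [← this, ← RingHom.map_det]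
    exact hp
  have htop := ((Module.Basis.is_basis_iff_det b).2 hgM.isUnit).2
  rw [← top_le_iff, ← htop]
  refine Submodule.span_mono ?_
  rintro _ ⟨i, rfl⟩
  exact ⟨W i, hW i, rfl⟩

end Descent

/-! ### Central simple algebras: scalar extension and splitting -/

section Splitting

variable {K : Type*} [Field K] {B : Type*} [Ring B] [Algebra K B]

/-- Every linear endomorphism of a central simple algebra is a sum of maps `x ↦ a * x * b`. -/
theorem mulLeftRight_surjective [FiniteDimensional K B] [Algebra.IsCentral K B] [IsSimpleRing B] :
    Function.Surjective (AlgHom.mulLeftRight K B) := by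
  let A := (AlgHom.mulLeftRight K B).range
  have hmem : ∀ a c : B, ∃ s : A, ∀ x : B, s • x = a * x * c := fun a c ↦
    ⟨⟨_, a ⊗ₜ MulOpposite.op c, rfl⟩, fun x ↦ AlgHom.mulLeftRight_apply K B a (MulOpposite.op c) x⟩
  -- The `A`-submodules of `B` are its two-sided ideals.
  have : IsSimpleModule A B := by
    have hnt : Nontrivial (Submodule A B) := Submodule.nontrivial_iff A |>.2 inferInstance
    refine (isSimpleModule_iff A B).2 ⟨fun N ↦ ?_⟩
    let I : Ideal B :=
      { carrier := N
        add_mem' := N.add_mem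
        zero_mem' := N.zero_mem
        smul_mem' := fun a x hx ↦ by
          obtain ⟨s, hs⟩ := hmem a 1
          have := N.smul_mem s hx
          rwa [hs, mul_one] at this }
    have hI : I.IsTwoSided := ⟨fun {x} c hx ↦ by
      obtain ⟨s, hs⟩ := hmem 1 c
      have : s • x ∈ N := N.smul_mem s hx
      rwa [hs, one_mul] at this⟩
    rcases (isSimpleRing_iff_isTwoSided_imp.1 ‹IsSimpleRing B›).2 I hI with h | h
    · exact .inl (by ext x; exact (SetLike.ext_iff.1 h x : x ∈ I ↔ _))
    · exact .inr (by ext x; exact (SetLike.ext_iff.1 h x : x ∈ I ↔ _))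
  intro p
  have hscalar : ∀ f : Module.End A B, ∃ k : K, ∀ x, f x = k • x := by
    intro f
    have hleft : ∀ x, f x = x * f 1 := fun x ↦ by
      obtain ⟨s, hs⟩ := hmem x 1
      have := map_smul f s 1
      rwa [hs, hs, mul_one, mul_one, mul_one] at this
    have hright : ∀ x, f x = f 1 * x := fun x ↦ by
      obtain ⟨s, hs⟩ := hmem 1 x
      have := map_smul f s 1
      rwa [hs, hs, one_mul, one_mul, one_mul] at this
    have hc : f 1 ∈ Subalgebra.center K B :=
      Subalgebra.mem_center_iff.2 fun x ↦ by rw [← hleft, hright]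
    rw [Algebra.IsCentral.center_eq_bot] at hc
    obtain ⟨k, hk⟩ := Algebra.mem_bot.1 hc
    exact ⟨k, fun x ↦ by rw [hright, ← hk, Algebra.smul_def]⟩
  -- By centrality `End_A B` consists of scalars, so every `K`-linear `p` commutes with it, and
  -- density realizes `p` on a finite basis.
  let P : Module.End (Module.End A B) B :=
    { toFun := p
      map_add' := p.map_add
      map_smul' := fun f x ↦ by
        obtain ⟨k, hk⟩ := hscalar f
        simp [Module.End.smul_def, hk] }
  let b := Module.finBasis K B
  classical
  obtain ⟨⟨_, t, rfl⟩, ht⟩ := jacobson_density (R := A) P (Finset.univ.image b)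
  refine ⟨t, b.ext fun i ↦ ?_⟩
  exact (ht (b i) (Finset.mem_image_of_mem _ (Finset.mem_univ i))).symm

/-- A central simple algebra stays simple after extension of scalars. -/
theorem isSimpleRing_baseChange [FiniteDimensional K B] [Algebra.IsCentral K B] [IsSimpleRing B]
    (L : Type*) [Field L] [Algebra K L] : IsSimpleRing (L ⊗[K] B) := by
  refine isSimpleRing_iff_isTwoSided_imp.2 ⟨inferInstance, fun I hI ↦ ?_⟩
  by_contra! hcon
  obtain ⟨y, hy, hy0⟩ := Submodule.ne_bot_iff _ |>.1 hcon.1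
  let b := Module.finBasis K B
  let c := Algebra.TensorProduct.basis L b
  obtain ⟨i, hi⟩ : ∃ i, c.repr y i ≠ 0 := by
    by_contra! h
    exact hy0 (c.ext_elem fun i ↦ by rw [h, map_zero]; rfl)
  have hstab : ∀ t : B ⊗[K] Bᵐᵒᵖ, (AlgHom.mulLeftRight K B t).baseChange L y ∈ I := by
    intro t
    induction t with
    | zero => simp
    | add s t hs ht =>
      rw [map_add, LinearMap.baseChange_add]
      exact I.add_mem hs ht
    | tmul a c =>
      have : ∀ z, (AlgHom.mulLeftRight K B (a ⊗ₜ c)).baseChange L z =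
          (1 ⊗ₜ a) * z * (1 ⊗ₜ c.unop) := fun z ↦ by
        induction z with
        | zero => simp
        | add s t hs ht => rw [map_add, hs, ht, mul_add, add_mul]
        | tmul l x => simp
      rw [this]
      exact I.mul_mem_right _ (I.mul_mem_left _ hy)
  -- Two-sided multiplications preserve `I`, and this one sends `y` to its nonzero coordinate
  -- `c.repr y i`, a unit.
  obtain ⟨t, ht⟩ := mulLeftRight_surjective (K := K) ((b.coord i).smulRight (1 : B))
  have hmem := hstab t
  have hval : ((b.coord i).smulRight (1 : B)).baseChange L = (c.coord i).smulRight 1 := by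
    refine c.ext fun k ↦ ?_
    simp [c, Finsupp.single_apply, Algebra.TensorProduct.one_def]
    split_ifs <;> simp
  rw [ht, hval, LinearMap.smulRight_apply, Module.Basis.coord_apply] at hmem
  refine hcon.2 ((Ideal.eq_top_iff_one I).2 ?_)
  have := I.mul_mem_left (algebraMap L _ (c.repr y i)⁻¹) hmem
  rwa [← Algebra.smul_def, smul_smul, inv_mul_cancel₀ hi, one_smul] at this

/-- A central simple algebra over a finite field is split. -/
theorem exists_algEquiv_matrix_of_finite [Finite K] [FiniteDimensional K B]
    [Algebra.IsCentral K B] [IsSimpleRing B] :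
    ∃ (n : ℕ) (_ : NeZero n), Nonempty (B ≃ₐ[K] Matrix (Fin n) (Fin n) K) := by
  have := IsArtinianRing.of_finite K B
  obtain ⟨n, hn, D, _, _, _, ⟨e⟩⟩ := IsSimpleRing.exists_algEquiv_matrix_divisionRing_finite K B
  refine ⟨n, hn, ⟨e.trans (AlgEquiv.mapMatrix (AlgEquiv.ofBijective (Algebra.ofId K D)
    ⟨(algebraMap K D).injective, fun d ↦ ?_⟩).symm)⟩⟩
  have : Finite D := Module.finite_of_finite K
  -- Commutativity of `D` makes its scalar matrices central in `B`, so `D = K`.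
  have hcomm : ∀ x y : D, x * y = y * x := (littleWedderburn D).mul_comm
  have hc : e.symm (Matrix.scalar (Fin n) d) ∈ Subalgebra.center K B := by
    refine Subalgebra.mem_center_iff.2 fun x ↦ e.injective ?_
    rw [map_mul, map_mul, AlgEquiv.apply_symm_apply]
    exact (Matrix.scalar_commute d (fun r ↦ hcomm d r) _).symm
  rw [Algebra.IsCentral.center_eq_bot] at hc
  obtain ⟨k, hk⟩ := Algebra.mem_bot.1 hc
  refine ⟨k, ?_⟩
  have h2 : e (algebraMap K B k) = Matrix.scalar (Fin n) d := by rw [hk, AlgEquiv.apply_symm_apply]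
  rw [AlgEquiv.commutes] at h2
  simpa [Matrix.algebraMap_matrix_apply] using congr($h2 0 0)

/-- The endomorphism algebra of `Kⁿ` as a matrix algebra. -/
theorem exists_algEquiv_end_of_matrix
    (h : ∃ (n : ℕ) (_ : NeZero n), Nonempty (B ≃ₐ[K] Matrix (Fin n) (Fin n) K)) :
    ∃ (n : ℕ) (_ : NeZero n), Nonempty (B ≃ₐ[K] Module.End K (Fin n → K)) := by
  obtain ⟨n, hn, ⟨e⟩⟩ := h
  exact ⟨n, hn, ⟨e.trans Matrix.toLinAlgEquiv'⟩⟩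

theorem exists_algEquiv_end_of_finite [Finite K] [FiniteDimensional K B]
    [Algebra.IsCentral K B] [IsSimpleRing B] :
    ∃ (n : ℕ) (_ : NeZero n), Nonempty (B ≃ₐ[K] Module.End K (Fin n → K)) :=
  exists_algEquiv_end_of_matrix exists_algEquiv_matrix_of_finite

variable (K B) in
theorem exists_algEquiv_baseChange_end [FiniteDimensional K B]
    [Algebra.IsCentral K B] [IsSimpleRing B] :
    ∃ (n : ℕ) (_ : NeZero n), Nonempty (AlgebraicClosure K ⊗[K] B ≃ₐ[AlgebraicClosure K]
      Module.End (AlgebraicClosure K) (Fin n → AlgebraicClosure K)) :=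
  have := isSimpleRing_baseChange (K := K) (B := B) (AlgebraicClosure K)
  exists_algEquiv_end_of_matrix (K := AlgebraicClosure K) (B := AlgebraicClosure K ⊗[K] B)
    (IsSimpleRing.exists_algEquiv_matrix_of_isAlgClosed (AlgebraicClosure K) _)

end Splitting

/-! ### Involutions of the first kind -/

section FirstKind

variable {K : Type*} [Field K] {B : Type*} [Ring B] [Algebra K B]

/-- `τ` is a canonical involution of quadratic type: `x + τ x` and `τ x * x` are scalars. -/
def IsCanonical (τ : B →ₗ[K] B) : Prop :=
  ∀ x, (∃ c : K, x + τ x = algebraMap K B c) ∧ ∃ d : K, τ x * x = algebraMap K B d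

theorem IsInvolution.baseChange {τ : B →ₗ[K] B} (hτ : IsInvolution τ) (L : Type*) [Field L]
    [Algebra K L] : IsInvolution (τ.baseChange L) where
  map_mul x y := by
    induction x with
    | zero => simp
    | add s t hs ht => rw [add_mul, map_add, hs, ht, map_add, mul_add]
    | tmul l x =>
      induction y with
      | zero => simp
      | add s t hs ht => rw [mul_add, map_add, hs, ht, map_add, add_mul]
      | tmul m y => simp [hτ.map_mul, mul_comm]
  involutive x := by
    induction x with
    | zero => simp
    | add s t hs ht => rw [map_add, map_add, hs, ht]
    | tmul l x => simp [hτ.involutive]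

theorem IsInvolution.conj {C : Type*} [Ring C] [Algebra K C] {τ : B →ₗ[K] B} (hτ : IsInvolution τ)
    (e : B ≃ₐ[K] C) : IsInvolution (e.toLinearMap ∘ₗ τ ∘ₗ e.symm.toLinearMap) where
  map_mul x y := by simp [hτ.map_mul]
  involutive x := by simp [hτ.involutive]

theorem exists_generates_of_baseChange [Infinite K] [FiniteDimensional K B] {τ : B →ₗ[K] B}
    (hτ : IsInvolution τ) (L : Type*) [Field L] [Algebra K L] {κ : Type*} {x : κ → L ⊗[K] B}
    (hx : Generates (τ.baseChange L) (Set.range x)) : ∃ y : κ → B, Generates τ (Set.range y) :=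
  exists_generates_range_of_baseChange hτ (hτ.baseChange L) Algebra.TensorProduct.includeRight
    (by simp) (Module.finBasis K B) (Algebra.TensorProduct.basis L (Module.finBasis K B))
    (by simp) hx

/-- An element of `B` that becomes scalar after extension of scalars is scalar. -/
theorem exists_algebraMap_of_one_tmul {L : Type*} [Field L] [Algebra K L] {x : B} {l : L}
    (h : (1 : L) ⊗ₜ[K] x = algebraMap L (L ⊗[K] B) l) : ∃ c : K, x = algebraMap K B c := by
  by_contra! hcon
  obtain ⟨f, hfx, hf⟩ := (Submodule.span K {(1 : B)}).exists_le_ker_of_notMem (v := x) (by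
    rw [Submodule.mem_span_singleton]
    rintro ⟨c, rfl⟩
    exact hcon c (Algebra.algebraMap_eq_smul_one c).symm)
  have hf1 : f 1 = 0 := hf (Submodule.mem_span_singleton_self _)
  have := congr(f.baseChange L $h)
  rw [Algebra.TensorProduct.algebraMap_apply, LinearMap.baseChange_tmul, LinearMap.baseChange_tmul,
    hf1, TensorProduct.tmul_zero] at this
  have h2 := congr(Algebra.TensorProduct.rid K L L $this)
  simp at h2
  exact hfx h2

theorem IsCanonical.of_baseChange {τ : B →ₗ[K] B} {L : Type*} [Field L] [Algebra K L]
    (h : IsCanonical (τ.baseChange L)) : IsCanonical τ := by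
  intro x
  obtain ⟨⟨c, hc⟩, ⟨d, hd⟩⟩ := h (1 ⊗ₜ x)
  rw [LinearMap.baseChange_tmul] at hc hd
  rw [← TensorProduct.tmul_add] at hc
  rw [Algebra.TensorProduct.tmul_mul_tmul, one_mul] at hd
  exact ⟨exists_algebraMap_of_one_tmul hc, exists_algebraMap_of_one_tmul hd⟩

/-- The trace condition is linear. The norm condition is quadratic, but its polarization `τ s * t +
τ t * s` is the trace of `τ s * t`. -/
theorem IsCanonical.baseChange {τ : B →ₗ[K] B} (hτ : IsInvolution τ) (h : IsCanonical τ)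
    (L : Type*) [Field L] [Algebra K L] : IsCanonical (τ.baseChange L) := by
  have htr : ∀ x, ∃ c : L, x + τ.baseChange L x = algebraMap L (L ⊗[K] B) c := by
    intro x
    induction x with
    | zero => exact ⟨0, by simp⟩
    | add s t hs ht =>
      obtain ⟨c, hc⟩ := hs
      obtain ⟨d, hd⟩ := ht
      exact ⟨c + d, by rw [map_add, map_add, ← hc, ← hd]; abel⟩
    | tmul l x =>
      obtain ⟨⟨c, hc⟩, -⟩ := h x
      refine ⟨c • l, ?_⟩
      rw [LinearMap.baseChange_tmul, ← TensorProduct.tmul_add, hc, Algebra.algebraMap_eq_smul_one,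
        ← TensorProduct.smul_tmul]
      rfl
  refine fun x ↦ ⟨htr x, ?_⟩
  have hτ' := hτ.baseChange L
  induction x with
  | zero => exact ⟨0, by simp⟩
  | add s t hs ht =>
    obtain ⟨c, hc⟩ := hs
    obtain ⟨d, hd⟩ := ht
    obtain ⟨a, ha⟩ := htr (τ.baseChange L s * t)
    rw [hτ'.map_mul, hτ'.involutive] at ha
    refine ⟨c + a + d, ?_⟩
    rw [map_add, map_add, map_add, ← hc, ← hd, ← ha]
    noncomm_ring
  | tmul l x =>
    obtain ⟨-, ⟨d, hd⟩⟩ := h x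
    refine ⟨d • (l * l), ?_⟩
    rw [LinearMap.baseChange_tmul, Algebra.TensorProduct.tmul_mul_tmul, hd,
      Algebra.algebraMap_eq_smul_one, ← TensorProduct.smul_tmul]
    rfl

theorem isCanonical_of_algEquiv_end {V : Type*} [AddCommGroup V] [Module K V]
    [FiniteDimensional K V] (e : B ≃ₐ[K] Module.End K V) (hV : Module.finrank K V = 2)
    {τ : B →ₗ[K] B} (hτ : IsInvolution τ) (h : ∀ (g : V) (φ : Module.Dual K V),
      (e.toLinearMap ∘ₗ τ ∘ₗ e.symm.toLinearMap) (φ.smulRight g) g = 0) : IsCanonical τ := by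
  intro x
  obtain ⟨⟨c, hc⟩, ⟨d, hd⟩⟩ :=
    (canonical_of_finrank_eq_two (hτ.conj e).isAntiInvolution hV h).2 (e x)
  refine ⟨⟨c, e.injective ?_⟩, ⟨d, e.injective ?_⟩⟩
  · simpa using hc
  · simpa using hd

theorem exists_generates_or_isCanonical_of_algEquiv_end {V : Type*} [AddCommGroup V] [Module K V]
    [FiniteDimensional K V] (e : B ≃ₐ[K] Module.End K V) (hV : 2 ≤ Module.finrank K V)
    {τ : B →ₗ[K] B} (hτ : IsInvolution τ) :
    (∃ x, Generates τ {x}) ∨ Module.finrank K V = 2 ∧ IsCanonical τ := by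
  have hσ := (hτ.conj e)
  by_cases h : 3 ≤ Module.finrank K V ∨ ∃ (g : V) (φ : Module.Dual K V),
      (e.toLinearMap ∘ₗ τ ∘ₗ e.symm.toLinearMap) (φ.smulRight g) g ≠ 0
  · left
    obtain ⟨x, -, hx⟩ := exists_isNilpotent_generator hσ.isAntiInvolution h
    refine ⟨e.symm x, ?_⟩
    rw [← Set.image_singleton]
    refine Generates.image_symm e (fun y ↦ ?_)
      (σ := e.toLinearMap ∘ₗ τ ∘ₗ e.symm.toLinearMap) fun A hA hst ↦ ?_
    · simp
    · have hxA : x ∈ A := hA rfl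
      exact hx A hxA (hst x hxA)
  · push Not at h
    have h2 : Module.finrank K V = 2 := by omega
    exact .inr ⟨h2, isCanonical_of_algEquiv_end e h2 hτ h.2⟩

theorem exists_pair_generates_of_algEquiv_end {V : Type*} [AddCommGroup V] [Module K V]
    [FiniteDimensional K V] [Nontrivial V] (e : B ≃ₐ[K] Module.End K V) (τ : B →ₗ[K] B) :
    ∃ x : Fin 2 → B, Generates τ (Set.range x) := by
  obtain ⟨n, hn⟩ : ∃ n, Module.finrank K V = n := ⟨_, rfl⟩
  have hpos := Module.finrank_pos (R := K) (M := V)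
  have : NeZero n := ⟨by omega⟩
  obtain ⟨b, y, hy, hyb⟩ := exists_shift_pair (F := K) (V := V) hn
  refine ⟨e.symm ∘ ![shift b, y], ?_⟩
  rw [Set.range_comp]
  refine Generates.image_symm e (σ := e.toLinearMap ∘ₗ τ ∘ₗ e.symm.toLinearMap) (by simp) ?_
  intro A hA _
  exact eq_top_of_shift_mem_of_isNilpotent b hy (.inl hyb) A (hA ⟨0, rfl⟩) (hA ⟨1, rfl⟩)

theorem IsFirstKind.finrank_eq {τ : B →ₗ[K] B} (hτ : IsFirstKind τ) {n : ℕ}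
    (hn : HasDegree K B n) : Module.finrank K B = n ^ 2 := by
  have := hτ.central
  have := hτ.simple
  rw [hn, Algebra.IsCentral.center_eq_bot, Subalgebra.finrank_bot, one_mul]

theorem finrank_of_algEquiv_end {V : Type*} [AddCommGroup V] [Module K V]
    [FiniteDimensional K V] (e : B ≃ₐ[K] Module.End K V) {n : ℕ}
    (hn : Module.finrank K B = n ^ 2) : Module.finrank K V = n := by
  have := e.toLinearEquiv.finrank_eq
  rw [hn, Module.finrank_linearMap, ← sq] at this
  exact (Nat.pow_left_injective two_ne_zero this).symm

/-- A finite `K` splits `B`. For infinite `K`, both alternatives descend from the algebraic closure.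
-/
theorem IsFirstKind.exists_generates_or_isCanonical {τ : B →ₗ[K] B} (hτ : IsFirstKind τ) {n : ℕ}
    (hn : HasDegree K B n) (h2 : 2 ≤ n) :
    (∃ x, Generates τ {x}) ∨ n = 2 ∧ IsCanonical τ := by
  have := hτ.finiteDimensional
  have := hτ.central
  have := hτ.simple
  have hfr := hτ.finrank_eq hn
  rcases finite_or_infinite K with hK | hK
  · obtain ⟨m, _, ⟨e⟩⟩ := exists_algEquiv_end_of_finite (K := K) (B := B)
    have hV := finrank_of_algEquiv_end e hfr
    rw [← hV] at h2 ⊢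
    exact exists_generates_or_isCanonical_of_algEquiv_end e h2 hτ.involution
  · obtain ⟨m, _, ⟨e⟩⟩ := exists_algEquiv_baseChange_end K B
    have hV := finrank_of_algEquiv_end e (by rw [Module.finrank_baseChange, hfr])
    rcases exists_generates_or_isCanonical_of_algEquiv_end e (by rwa [hV])
      (hτ.involution.baseChange _) with ⟨x, hx⟩ | ⟨h, hc⟩
    · rw [← Set.range_const (ι := Unit)] at hx
      obtain ⟨y, hy⟩ := exists_generates_of_baseChange hτ.involution _ hx
      exact .inl ⟨y (), by rwa [← Set.range_unique]⟩
    · exact .inr ⟨hV ▸ h, hc.of_baseChange⟩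

theorem IsFirstKind.exists_pair_generates {τ : B →ₗ[K] B} (hτ : IsFirstKind τ) :
    ∃ x : Fin 2 → B, Generates τ (Set.range x) := by
  have := hτ.finiteDimensional
  have := hτ.central
  have := hτ.simple
  rcases finite_or_infinite K with hK | hK
  · obtain ⟨m, _, ⟨e⟩⟩ := exists_algEquiv_end_of_finite (K := K) (B := B)
    exact exists_pair_generates_of_algEquiv_end e τ
  · obtain ⟨m, _, ⟨e⟩⟩ := exists_algEquiv_baseChange_end K B
    obtain ⟨x, hx⟩ := exists_pair_generates_of_algEquiv_end e (τ.baseChange _)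
    exact exists_generates_of_baseChange hτ.involution _ hx

end FirstKind

/-! ### Exchange involutions of central simple algebras; unitary involutions on products -/

section Unitary

/-- The exchange involution of a central simple algebra and its opposite is generated by one
element. -/
theorem exists_generates_exchange (F : Type*) [Field F] (C : Type*) [Ring C] [Algebra F C]
    [FiniteDimensional F C] [Algebra.IsCentral F C] [IsSimpleRing C] :
    ∃ z, Generates (exchange F C) {z} := by
  rcases finite_or_infinite F with hF | hF
  · obtain ⟨m, _, ⟨e⟩⟩ := exists_algEquiv_end_of_finite (K := F) (B := C)
    obtain ⟨z, hz⟩ := exists_generates_exchange_end (F := F) (V := Fin m → F)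
    exact ⟨_, Set.image_singleton ▸
      hz.image_symm (AlgEquiv.prodCongr e (AlgEquiv.op e)) fun x ↦ rfl⟩
  · obtain ⟨m, _, ⟨e⟩⟩ := exists_algEquiv_baseChange_end F C
    obtain ⟨z, hz⟩ := exists_generates_exchange_end (F := AlgebraicClosure F)
      (V := Fin m → AlgebraicClosure F)
    rw [← Set.range_const (ι := Unit)] at hz
    let k : C →ₐ[F] Module.End (AlgebraicClosure F) (Fin m → AlgebraicClosure F) :=
      (e.toAlgHom.restrictScalars F).comp Algebra.TensorProduct.includeRight
    let b := Module.finBasis F C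
    let c := (Algebra.TensorProduct.basis (AlgebraicClosure F) b).map e.toLinearEquiv
    obtain ⟨y, hy⟩ := exists_generates_range_of_baseChange isInvolution_exchange
      isInvolution_exchange (AlgHom.prodMap k (AlgHom.op k)) (fun _ ↦ rfl)
      (b.prod (b.map (MulOpposite.opLinearEquiv F)))
      (c.prod (c.map (MulOpposite.opLinearEquiv _))) (by
        have hj : ∀ p, AlgHom.prodMap k (AlgHom.op k) p =
          (k p.1, MulOpposite.op (k p.2.unop)) := fun _ ↦ rfl
        rintro (i | i) <;> rw [hj] <;> simp [c, k]) hz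
    exact ⟨y (), by rwa [← Set.range_unique]⟩

/-- A unitary involution on a product of two simple algebras is an exchange involution. -/
theorem exists_generates_of_algEquiv_prod {K : Type*} [Field K] {B B₁ B₂ : Type*} [Ring B]
    [Algebra K B] [FiniteDimensional K B] [Ring B₁] [Ring B₂] [Algebra K B₁] [Algebra K B₂]
    [IsSimpleRing B₁] [Nontrivial B₂] (e : B ≃ₐ[K] B₁ × B₂)
    (hZ : Module.finrank K (Subalgebra.center K B) = 2) {τ : B →ₗ[K] B} (hτ : IsInvolution τ)
    (hnt : ∃ z ∈ Subalgebra.center K B, τ z ≠ z) : ∃ x, Generates τ {x} := by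
  have hfin : FiniteDimensional K (B₁ × B₂) := Module.Finite.equiv e.toLinearEquiv
  have hfin₁ : FiniteDimensional K B₁ := Module.Finite.of_surjective (LinearMap.fst K B₁ B₂)
    LinearMap.fst_surjective
  have hcen : ∀ x, x ∈ Subalgebra.center K B ↔ e x ∈ Subalgebra.center K (B₁ × B₂) := fun x ↦ by
    simp only [Subalgebra.mem_center_iff]
    constructor
    · intro h p
      obtain ⟨y, rfl⟩ := e.surjective p
      rw [← map_mul, h, map_mul]
    · intro h y
      exact e.injective (by rw [map_mul, h, map_mul])
  -- the center is spanned by the two central idempotents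
  have hspan : ∀ p ∈ Subalgebra.center K (B₁ × B₂),
      ∃ a c : K, p = (algebraMap K B₁ a, algebraMap K B₂ c) := by
    have h1 : ((1, 0) : B₁ × B₂) ∈ Subalgebra.center K (B₁ × B₂) :=
      Subalgebra.mem_center_iff.2 fun p ↦ by ext <;> simp
    have h2 : ((0, 1) : B₁ × B₂) ∈ Subalgebra.center K (B₁ × B₂) :=
      Subalgebra.mem_center_iff.2 fun p ↦ by ext <;> simp
    have hZ' : Module.finrank K (Subalgebra.center K (B₁ × B₂)) = 2 := by
      rw [← hZ]
      refine (LinearEquiv.finrank_eq ?_).symm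
      refine e.toLinearEquiv.ofSubmodules (Subalgebra.toSubmodule (Subalgebra.center K B))
        (Subalgebra.toSubmodule (Subalgebra.center K (B₁ × B₂))) ?_
      ext p
      constructor
      · rintro ⟨x, hx, rfl⟩
        exact (hcen x).1 hx
      · intro hp
        exact ⟨e.symm p, (hcen _).2 (by rwa [AlgEquiv.apply_symm_apply]), e.apply_symm_apply p⟩
    let w : Fin 2 → Subalgebra.center K (B₁ × B₂) := ![⟨_, h1⟩, ⟨_, h2⟩]
    have hw : LinearIndependent K w := by
      rw [LinearIndependent.pair_iff]
      intro s t hst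
      have := congr(($hst : B₁ × B₂))
      simpa [Prod.ext_iff] using this
    have htop := hw.span_eq_top_of_card_eq_finrank (by rw [hZ', Fintype.card_fin])
    intro p hp
    have hmem : (⟨p, hp⟩ : Subalgebra.center K (B₁ × B₂)) ∈ Submodule.span K (Set.range w) :=
      htop ▸ Submodule.mem_top
    rw [Matrix.range_cons, Matrix.range_cons, Matrix.range_empty, Set.union_empty,
      Set.singleton_union, Submodule.mem_span_pair] at hmem
    obtain ⟨a, c, hac⟩ := hmem
    refine ⟨a, c, ?_⟩
    have := congr(($hac : B₁ × B₂))
    simp only [Subalgebra.coe_add, Subalgebra.coe_smul] at this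
    rw [← this]
    simp [Algebra.algebraMap_eq_smul_one]
  have hcentral : Algebra.IsCentral K B₁ := ⟨fun z hz ↦ by
    obtain ⟨a, c, hac⟩ := hspan (z, 0) (Subalgebra.mem_center_iff.2 fun p ↦ by
      ext
      · exact Subalgebra.mem_center_iff.1 hz p.1
      · simp)
    exact ⟨a, congr(($hac).1).symm⟩⟩
  let σ := e.toLinearMap ∘ₗ τ ∘ₗ e.symm.toLinearMap
  have hσ : IsInvolution σ := hτ.conj e
  have hσcen : ∀ p ∈ Subalgebra.center K (B₁ × B₂), σ p ∈ Subalgebra.center K (B₁ × B₂) := by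
    intro p hp
    refine Subalgebra.mem_center_iff.2 fun q ↦ ?_
    rw [← hσ.involutive q, ← hσ.map_mul, ← hσ.map_mul, Subalgebra.mem_center_iff.1 hp]
  have hadd : σ (1, 0) + σ (0, 1) = 1 := by
    rw [← map_add, Prod.mk_add_mk, add_zero, zero_add]
    exact hσ.map_one
  -- the two idempotents are exchanged
  have hswap : σ (1, 0) = (0, 1) := by
    obtain ⟨a, c, hac⟩ := hspan _ (hσcen (1, 0)
      (Subalgebra.mem_center_iff.2 fun p ↦ by ext <;> simp))
    have hidem : σ (1, 0) * σ (1, 0) = σ (1, 0) := by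
      rw [← hσ.map_mul]; simp
    rw [hac, Prod.mk_mul_mk, Prod.mk.injEq, ← map_mul, ← map_mul,
      (algebraMap K B₁).injective.eq_iff, (algebraMap K B₂).injective.eq_iff] at hidem
    rcases IsIdempotentElem.iff_eq_zero_or_one.1 hidem.1 with rfl | rfl <;>
      rcases IsIdempotentElem.iff_eq_zero_or_one.1 hidem.2 with rfl | rfl
    · have := hσ.isAntiInvolution.injective (hac.trans (by simp : _ = (0 : B₁ × B₂))
        |>.trans (map_zero σ).symm)
      simp at this
    · simpa using hac
    · exfalso
      have h1 : σ (1, 0) = (1, 0) := by simpa using hac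
      have h2 : σ (0, 1) = (0, 1) := by
        rw [h1] at hadd
        rw [← add_right_inj, hadd]; simp; rfl
      obtain ⟨z, hz, hne⟩ := hnt
      obtain ⟨a, c, hz'⟩ := hspan _ ((hcen z).1 hz)
      refine hne (e.injective ?_)
      have h3 : σ (e z) = e (τ z) := by simp [σ]
      have h4 : e z = a • (1, 0) + c • (0, 1) := by
        rw [hz']; simp [Algebra.algebraMap_eq_smul_one]
      rw [← h3, h4, map_add, map_smul, map_smul, h1, h2]
    · have := hσ.isAntiInvolution.injective (hac.trans (by simp : _ = (1 : B₁ × B₂))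
        |>.trans hσ.map_one.symm)
      simp [Prod.ext_iff] at this
  have hswap' : σ (0, 1) = (1, 0) := by rw [← hswap, hσ.involutive]
  have hl : ∀ x : B₁, (σ (x, 0)).1 = 0 := fun x ↦ by
    have : σ (x, 0) = σ (1, 0) * σ (x, 0) := by rw [← hσ.map_mul]; simp
    rw [this, hswap]; simp
  -- Since `σ` exchanges the factors, it identifies `B₂` with the opposite of `B₁` and becomes the
  -- exchange map.
  let Φ : (B₁ × B₂) →ₐ[K] B₁ × B₁ᵐᵒᵖ := AlgHom.ofLinearMap
    ((LinearMap.fst K B₁ B₂).prod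
      ((MulOpposite.opLinearEquiv K).toLinearMap ∘ₗ LinearMap.fst K B₁ B₂ ∘ₗ σ))
    (by
      have := hσ.map_one
      ext <;> simp [this])
    (fun p q ↦ by ext <;> simp [hσ.map_mul])
  have hΦ : ∀ p, Φ p = (p.1, MulOpposite.op (σ p).1) := fun p ↦ rfl
  have hbij : Function.Bijective Φ := by
    constructor
    · rw [injective_iff_map_eq_zero]
      intro p hp
      rw [hΦ, Prod.mk_eq_zero, MulOpposite.op_eq_zero_iff] at hp
      have h1 : p = p * (0, 1) := by ext <;> simp [hp.1]
      have h2 : σ p = 0 := by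
        rw [h1, hσ.map_mul, hswap']
        ext <;> simp [hp.2]
      rw [← hσ.involutive p, h2, map_zero]
    · rintro ⟨x, y⟩
      refine ⟨(x, 0) + σ (y.unop, 0), ?_⟩
      rw [hΦ, map_add, hσ.involutive, Prod.fst_add, Prod.fst_add, hl, hl]
      simp
  obtain ⟨z, hz⟩ := exists_generates_exchange K B₁
  exact ⟨_, Set.image_singleton ▸ hz.image_symm (e.trans (AlgEquiv.ofBijective Φ hbij)) fun x ↦ by
    have h3 : e (τ x) = σ (e x) := by simp [σ]
    simp only [AlgEquiv.trans_apply, AlgEquiv.coe_ofBijective, hΦ, h3, hσ.involutive]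
    rfl⟩

end Unitary

/-! ### Unitary involutions whose center is a field -/

section UnitarySimple

variable {K Z B : Type*} [Field K] [Field Z] [Algebra K Z] [Ring B] [Algebra K B] [Algebra Z B]
  [IsScalarTower K Z B]

/-- An anti-involution of `End V` that is not the identity on scalars is generated over the scalars
by a nilpotent endomorphism. -/
theorem exists_isNilpotent_generator_of_ne {V : Type*} [AddCommGroup V] [Module Z V]
    [FiniteDimensional Z V] [Nontrivial V] {σ : Module.End Z V → Module.End Z V}
    (hσ : IsAntiInvolution σ) (hne : ∃ a : Z, σ (algebraMap Z _ a) ≠ algebraMap Z _ a) :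
    ∃ x : Module.End Z V, IsNilpotent x ∧
      ∀ A : Subalgebra Z (Module.End Z V), x ∈ A → σ x ∈ A → A = ⊤ := by
  by_cases h : 3 ≤ Module.finrank Z V ∨ ∃ (g : V) (φ : Module.Dual Z V), σ (φ.smulRight g) g ≠ 0
  · exact exists_isNilpotent_generator hσ h
  · push Not at h
    have hpos := Module.finrank_pos (R := Z) (M := V)
    by_cases h2 : Module.finrank Z V = 2
    · obtain ⟨a, ha⟩ := hne
      exact absurd ((canonical_of_finrank_eq_two hσ h2 h.2).1 a) ha
    · refine ⟨0, IsNilpotent.zero, fun A _ _ ↦ ?_⟩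
      have h1 : Module.finrank Z V = 1 := by omega
      rw [eq_top_iff, ← Subalgebra.bot_eq_top_of_finrank_eq_one
        (by rw [Module.finrank_linearMap, h1])]
      exact bot_le

/-- The generator is `a + N`, with `a` central and moved by `τ`. Once `a` is recovered, it generates
`Z`, because `Z` has prime degree 2 over `K`; so the subalgebra is a `Z`-algebra, and the result for
`End V` applies. -/
theorem exists_generates_of_finite_of_isCentral [Finite K] [FiniteDimensional K B]
    [FiniteDimensional K Z] [Algebra.IsCentral Z B] [IsSimpleRing B]
    (hZ : Module.finrank K Z = 2) {τ : B →ₗ[K] B} (hτ : IsInvolution τ)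
    (hnt : ∃ a : Z, τ (algebraMap Z B a) ≠ algebraMap Z B a) : ∃ x, Generates τ {x} := by
  obtain ⟨a, ha⟩ := hnt
  have : Finite Z := Module.finite_of_finite K
  have : Fintype Z := Fintype.ofFinite Z
  have : FiniteDimensional Z B := FiniteDimensional.right K Z B
  obtain ⟨m, _, ⟨e⟩⟩ := exists_algEquiv_end_of_finite (K := Z) (B := B)
  have hσ : IsAntiInvolution fun X ↦ e (τ (e.symm X)) :=
    ⟨fun x y ↦ by simp, fun x y ↦ by simp [hτ.map_mul], fun x ↦ by simp [hτ.involutive]⟩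
  obtain ⟨N, ⟨r, hr⟩, hN⟩ := exists_isNilpotent_generator_of_ne hσ
    ⟨a, fun h ↦ ha (e.injective (by simpa using h))⟩
  have hr' : e.symm N ^ r = 0 := by rw [← map_pow, hr, map_zero]
  refine ⟨algebraMap Z B a + e.symm N, fun A hA hst ↦ ?_⟩
  rw [Set.singleton_subset_iff] at hA
  have haA : algebraMap Z B a ∈ A := by
    obtain ⟨p, hp⟩ := CharP.exists Z
    obtain ⟨d, hpp, hd⟩ := FiniteField.card Z p
    have : Fact p.Prime := ⟨hpp⟩
    have : CharP B p := charP_of_injective_algebraMap (algebraMap Z B).injective p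
    -- With `q = p ^ d = |Z|`, the exponent is `q ^ r`: it fixes `a`, and it kills `N` because `q ^
    -- r > r`.
    have hpow : (algebraMap Z B a + e.symm N) ^ p ^ (d * r) = algebraMap Z B a := by
      rw [add_pow_char_pow_of_commute p _ (Algebra.commutes a _), ← map_pow, pow_mul, ← hd,
        FiniteField.pow_card_pow, pow_eq_zero_of_le _ hr', add_zero]
      exact (Nat.lt_pow_self Fintype.one_lt_card).le
    exact hpow ▸ A.pow_mem hA _
  have hNA : e.symm N ∈ A := by simpa using A.sub_mem hA haA
  have hZA : ∀ z : Z, algebraMap Z B z ∈ A := by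
    let S : Subalgebra K Z := A.comap (IsScalarTower.toAlgHom K Z B)
    have := Subalgebra.isSimpleOrder_of_finrank_prime K Z (by rw [hZ]; exact Nat.prime_two)
    have hS : S = ⊤ := by
      refine (eq_bot_or_eq_top S).resolve_left fun h ↦ ?_
      have : a ∈ S := haA
      rw [h] at this
      obtain ⟨k, rfl⟩ := Algebra.mem_bot.1 this
      refine ha ?_
      rw [← IsScalarTower.algebraMap_apply, Algebra.algebraMap_eq_smul_one, map_smul, hτ.map_one]
    intro z
    have : z ∈ S := hS ▸ Algebra.mem_top
    exact this
  let A' : Subalgebra Z B := { A.toSubsemiring with algebraMap_mem' := hZA }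
  have htop : A'.map e.toAlgHom = ⊤ :=
    hN _ ⟨e.symm N, hNA, by simp⟩ ⟨τ (e.symm N), hst _ hNA, rfl⟩
  rw [eq_top_iff]
  intro x _
  obtain ⟨y, hy, hyx⟩ : e x ∈ A'.map e.toAlgHom := htop ▸ Algebra.mem_top
  rwa [← e.injective hyx]

/-- The embedding of an algebra with involution in an exchange involution. -/
def toExchange {τ : B →ₗ[K] B} (hτ : IsInvolution τ) : B →ₐ[K] B × Bᵐᵒᵖ :=
  AlgHom.ofLinearMap
    (LinearMap.id.prod ((MulOpposite.opLinearEquiv K).toLinearMap ∘ₗ τ))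
    (by ext <;> simp [hτ.map_one]) (fun p q ↦ by ext <;> simp [hτ.map_mul])

theorem toExchange_apply {τ : B →ₗ[K] B} (hτ : IsInvolution τ) (x : B) :
    toExchange hτ x = (x, MulOpposite.op (τ x)) := rfl

/-- Under `toExchange` a `K`-basis of `B` becomes a `Z`-basis of `B × Bᵐᵒᵖ`, so the generator of the
exchange involution over `Z` descends to `K`. -/
theorem exists_generates_of_infinite_of_isCentral [Infinite K] [FiniteDimensional K B]
    [FiniteDimensional K Z] [Algebra.IsCentral Z B] [IsSimpleRing B]
    (hZ : Module.finrank K Z = 2) {τ : B →ₗ[K] B} (hτ : IsInvolution τ)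
    (hnt : ∃ a : Z, τ (algebraMap Z B a) ≠ algebraMap Z B a) : ∃ x, Generates τ {x} := by
  obtain ⟨a, ha⟩ := hnt
  have : FiniteDimensional Z B := FiniteDimensional.right K Z B
  let b := Module.finBasis K B
  let S := Submodule.span Z (Set.range (toExchange hτ ∘ b))
  have hτa : ∃ a' : Z, τ (algebraMap Z B a) = algebraMap Z B a' := by
    have : τ (algebraMap Z B a) ∈ Subalgebra.center Z B := by
      refine Subalgebra.mem_center_iff.2 fun y ↦ ?_
      rw [← hτ.involutive y, ← hτ.map_mul, ← hτ.map_mul, Algebra.commutes]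
    rw [Algebra.IsCentral.center_eq_bot] at this
    obtain ⟨a', h⟩ := Algebra.mem_bot.1 this
    exact ⟨a', h.symm⟩
  obtain ⟨a', ha'⟩ := hτa
  have hne : a' - a ≠ 0 := fun h ↦ ha (by rw [ha', sub_eq_zero.1 h])
  have hS : ∀ x, toExchange hτ x ∈ S := fun x ↦ by
    rw [← b.sum_repr x, map_sum]
    refine S.sum_mem fun i _ ↦ ?_
    rw [map_smul, ← algebraMap_smul Z]
    exact S.smul_mem _ (Submodule.subset_span ⟨i, rfl⟩)
  -- The images of `a * τ y` and `τ y` have second components `a' * y` and `y`; subtracting `a`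
  -- times the latter leaves `(0, (a' - a) * y)`.
  have hsnd : ∀ y : B, ((0, MulOpposite.op y) : B × Bᵐᵒᵖ) ∈ S := fun y ↦ by
    have hmem := S.smul_mem (a' - a)⁻¹
      (S.sub_mem (hS (algebraMap Z B a * τ y)) (S.smul_mem a (hS (τ y))))
    convert hmem using 1
    rw [toExchange_apply, toExchange_apply, hτ.map_mul, hτ.involutive, ha', ← Algebra.commutes,
      ← Algebra.smul_def, ← Algebra.smul_def]
    ext
    · simp
    · simp [← sub_smul, smul_smul, inv_mul_cancel₀ hne]
  have htop : ⊤ ≤ S := by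
    rintro ⟨x, y⟩ -
    have := S.add_mem (S.sub_mem (hS x) (hsnd (τ x))) (hsnd y.unop)
    simpa [toExchange_apply] using this
  have hcard : Fintype.card (Fin (Module.finrank K B)) = Module.finrank Z (B × Bᵐᵒᵖ) := by
    rw [Fintype.card_fin, ← Module.finrank_mul_finrank K Z B, hZ, Module.finrank_prod,
      ← (MulOpposite.opLinearEquiv Z : B ≃ₗ[Z] Bᵐᵒᵖ).finrank_eq, two_mul]
  obtain ⟨z, hz⟩ := exists_generates_exchange Z B
  rw [← Set.range_const (ι := Unit)] at hz
  obtain ⟨y, hy⟩ := exists_generates_range_of_baseChange hτ isInvolution_exchange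
    (toExchange hτ) (fun x ↦ by simp [toExchange_apply, hτ.involutive]) b
    (basisOfTopLeSpanOfCardEqFinrank _ htop hcard)
    (fun i ↦ by rw [coe_basisOfTopLeSpanOfCardEqFinrank]; rfl) hz
  exact ⟨y (), by rwa [← Set.range_unique]⟩

end UnitarySimple

/-! ### All unitary involutions -/

section UnitaryMain

variable {K : Type*} [Field K] {B : Type*} [Ring B] [Algebra K B]

theorem exists_generates_of_isField {Z : Type*} [CommRing Z] (hF : IsField Z) [Algebra K Z]
    [Algebra Z B] [IsScalarTower K Z B] [FiniteDimensional K B] [FiniteDimensional K Z]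
    [Algebra.IsCentral Z B] [IsSimpleRing B] (hZ : Module.finrank K Z = 2) {τ : B →ₗ[K] B}
    (hτ : IsInvolution τ) (hnt : ∃ a : Z, τ (algebraMap Z B a) ≠ algebraMap Z B a) :
    ∃ x, Generates τ {x} := by
  let := hF.toField
  rcases finite_or_infinite K with hK | hK
  · exact exists_generates_of_finite_of_isCentral hZ hτ hnt
  · exact exists_generates_of_infinite_of_isCentral hZ hτ hnt

theorem isField_center [IsSimpleRing B] : IsField (Subalgebra.center K B) := by
  refine MulEquiv.isField (IsSimpleRing.isField_center B)
    { toFun := fun z ↦ ⟨z.1, Subring.mem_center_iff.2 (Subalgebra.mem_center_iff.1 z.2)⟩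
      invFun := fun z ↦ ⟨z.1, Subalgebra.mem_center_iff.2 (Subring.mem_center_iff.1 z.2)⟩
      left_inv := fun _ ↦ rfl
      right_inv := fun _ ↦ rfl
      map_mul' := fun _ _ ↦ rfl }

theorem IsUnitary.exists_generates {τ : B →ₗ[K] B} (hτ : IsUnitary τ) : ∃ x, Generates τ {x} := by
  have := hτ.finiteDimensional
  rcases hτ.simple_or_prod with hs | ⟨B₁, B₂, _, _, _, _, _, _, ⟨e⟩⟩
  · let : Algebra (Subalgebra.center K B) B :=
      { (inferInstance : SMul (Subalgebra.center K B) B) with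
        algebraMap := (Subalgebra.center K B).val.toRingHom
        commutes' := fun z x ↦ (Subalgebra.mem_center_iff.1 z.2 x).symm
        smul_def' := fun z x ↦ rfl }
    have : IsScalarTower K (Subalgebra.center K B) B := Subalgebra.isScalarTower_mid _
    have : Algebra.IsCentral (Subalgebra.center K B) B := ⟨fun z hz ↦
      ⟨⟨z, Subalgebra.mem_center_iff.2 (Subalgebra.mem_center_iff.1 hz)⟩, rfl⟩⟩
    have : FiniteDimensional K (Subalgebra.center K B) := inferInstance
    obtain ⟨z, hz, hne⟩ := hτ.nontrivial_on_center
    exact exists_generates_of_isField isField_center hτ.finrank_center hτ.involution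
      ⟨⟨z, hz⟩, hne⟩
  · exact exists_generates_of_algEquiv_prod e hτ.finrank_center hτ.involution
      hτ.nontrivial_on_center

end UnitaryMain

/-! ### Adjoint forms, and symplectic involutions in degrees 1 and 2 -/

section AdjointForm

/-- Every involution of `End V` that is linear over the base field is the adjoint involution of a
nondegenerate bilinear form. -/
theorem IsInvolution.exists_nondegenerate_form {F : Type*} [Field F] {V : Type*} [AddCommGroup V]
    [Module F V] [FiniteDimensional F V] {σ : Module.End F V →ₗ[F] Module.End F V}
    (hσ : IsInvolution σ) :
    ∃ b : LinearMap.BilinForm F V, b.Nondegenerate ∧ ∀ X v w, b (σ X v) w = b v (X w) := by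
  -- Transposition after `σ` is multiplicative, hence an isomorphism by dimension. Such an
  -- isomorphism is conjugation by some linear `T : V ≃ V*`, and `T` is the form.
  let f : Module.End F V →ₐ[F] Module.End F (Module.Dual F V) := AlgHom.ofLinearMap
    (Module.Dual.transpose ∘ₗ σ)
    (by rw [LinearMap.comp_apply, hσ.map_one]; rfl)
    (fun X Y ↦ by rw [LinearMap.comp_apply, hσ.map_mul]; rfl)
  have hf : ∀ X φ v, f X φ v = φ (σ X v) := fun X φ v ↦ rfl
  have hinj : Function.Injective f := by
    rw [injective_iff_map_eq_zero]
    intro X hX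
    have : σ X = 0 := LinearMap.ext fun v ↦ (Module.forall_dual_apply_eq_zero_iff F _).1 fun φ ↦ by
      rw [← hf, hX]; rfl
    rw [← hσ.involutive X, this, map_zero]
  have hfin : Module.finrank F (Module.End F V) =
      Module.finrank F (Module.End F (Module.Dual F V)) := by
    rw [Module.finrank_linearMap F F V V,
      Module.finrank_linearMap F F (Module.Dual F V) (Module.Dual F V), Subspace.dual_finrank_eq]
  have hiff := LinearMap.injective_iff_surjective_of_finrank_eq_finrank (K := F)
    (V := Module.End F V) (V₂ := Module.End F (Module.Dual F V)) (f := f.toLinearMap) hfin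
  have hsurj : Function.Surjective f := hiff.1 hinj
  obtain ⟨T, hT⟩ := (AlgEquiv.ofBijective f ⟨hinj, hsurj⟩).eq_linearEquivConjAlgEquiv
  have hfT : ∀ X v, T (X v) = f X (T v) := fun X v ↦ by
    have : f X = T.conjAlgEquiv F X := congr($hT X)
    rw [this, LinearEquiv.conjAlgEquiv_apply]
    simp
  refine ⟨T.toLinearMap, ⟨fun v hv ↦ ?_, fun w hw ↦ ?_⟩, fun X v w ↦ ?_⟩
  · exact T.map_eq_zero_iff.1 (LinearMap.ext hv)
  · refine (Module.forall_dual_apply_eq_zero_iff F _).1 fun φ ↦ ?_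
    have := hw (T.symm φ)
    simpa using this
  · change T (σ X v) w = T v (X w)
    rw [hfT, hf, hσ.involutive]

variable {K : Type u} [Field K] {B : Type v} [Ring B] [Algebra K B] {τ : B →ₗ[K] B}

theorem IsFirstKind.exists_isAdjointTo (hτ : IsFirstKind τ) {n : ℕ} (hn : HasDegree K B n) :
    ∃ (m : ℕ) (φ : AlgebraicClosure K ⊗[K] B ≃ₐ[AlgebraicClosure K]
        Module.End (AlgebraicClosure K) (Fin m → AlgebraicClosure K))
      (b : LinearMap.BilinForm (AlgebraicClosure K) (Fin m → AlgebraicClosure K)),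
      Module.finrank (AlgebraicClosure K) (Fin m → AlgebraicClosure K) = n ∧
        IsAdjointTo τ φ b := by
  have := hτ.finiteDimensional
  have := hτ.central
  have := hτ.simple
  obtain ⟨m, _, ⟨φ⟩⟩ := exists_algEquiv_baseChange_end K B
  obtain ⟨b, hb, hadj⟩ :=
    ((hτ.involution.baseChange (AlgebraicClosure K)).conj φ).exists_nondegenerate_form
  refine ⟨m, φ, b, finrank_of_algEquiv_end φ
    (by rw [Module.finrank_baseChange, hτ.finrank_eq hn]), hb, fun x v w ↦ ?_⟩
  have := hadj (φ x) v w
  simpa using this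

theorem IsFirstKind.not_isSymplectic_of_degree_one (hτ : IsFirstKind τ) (hn : HasDegree K B 1) :
    ¬ IsSymplectic τ := by
  intro hs
  obtain ⟨m, φ, b, hm, hadj⟩ := hτ.exists_isAdjointTo hn
  have halt := hs.2 _ _ φ b hadj
  have := Module.nontrivial_of_finrank_pos (R := AlgebraicClosure K)
    (M := Fin m → AlgebraicClosure K) (by omega)
  obtain ⟨v, hv⟩ := exists_ne (0 : Fin m → AlgebraicClosure K)
  refine hv (hadj.1.1 v fun w ↦ ?_)
  obtain ⟨c, rfl⟩ := (finrank_eq_one_iff_of_nonzero' v hv).1 hm w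
  rw [map_smul, halt v, smul_zero]

/-- For `b` alternating, with adjoint involution `σ`, `b (σ (ψ.smulRight g) g) w = ψ w • b g g = 0`,
so `σ` is alternating in the rank-one sense. -/
theorem IsSymplectic.isCanonical (hs : IsSymplectic τ) (hn : HasDegree K B 2) :
    IsCanonical τ := by
  obtain ⟨m, φ, b, hm, hadj⟩ := hs.1.exists_isAdjointTo hn
  have halt := hs.2 _ _ φ b hadj
  refine IsCanonical.of_baseChange (L := AlgebraicClosure K)
    (isCanonical_of_algEquiv_end φ hm (hs.1.involution.baseChange _) fun g ψ ↦ ?_)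
  refine hadj.1.1 _ fun w ↦ ?_
  have := hadj.2 (φ.symm (ψ.smulRight g)) g w
  rw [AlgEquiv.apply_symm_apply, LinearMap.smulRight_apply, map_smul, halt g, smul_zero] at this
  exact this

/-- Take a rank-one idempotent `x` fixing `w`. The scalar `τ x * x` kills the nonzero kernel of `x`,
so it vanishes, and `b w w = b (τ x (x w)) w = 0`. -/
theorem IsFirstKind.isSymplectic_of_isCanonical (hτ : IsFirstKind τ) (hn : HasDegree K B 2)
    (hc : IsCanonical τ) : IsSymplectic τ := by
  refine ⟨hτ, fun L _ _ V _ _ _ φ b hadj w ↦ ?_⟩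
  have := hτ.finiteDimensional
  have hV : Module.finrank L V = 2 := finrank_of_algEquiv_end φ
    (by rw [Module.finrank_baseChange, hτ.finrank_eq hn])
  rcases eq_or_ne w 0 with rfl | hw
  · simp
  obtain ⟨ψ, hψ⟩ := Module.Projective.exists_dual_eq_one L hw
  obtain ⟨v, hv, hv0⟩ : ∃ v ∈ LinearMap.ker ψ, v ≠ 0 := by
    refine (Submodule.ne_bot_iff _).1 fun h ↦ ?_
    have := LinearMap.finrank_le_finrank_of_injective (LinearMap.ker_eq_bot.1 h)
    rw [hV, Module.finrank_self] at this
    omega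
  rw [LinearMap.mem_ker] at hv
  let x := φ.symm (ψ.smulRight w)
  have hx : ∀ z, φ x z = ψ z • w := fun z ↦ by simp [x]
  obtain ⟨d, hd⟩ := (hc.baseChange hτ.involution L x).2
  have hd' : ∀ z, φ (τ.baseChange L x) (φ x z) = d • z := fun z ↦ by
    rw [← Module.End.mul_apply, ← map_mul, hd, AlgEquiv.commutes, Module.algebraMap_end_apply]
  have hd0 : d = 0 := by
    have := hd' v
    rw [hx, hv, zero_smul, map_zero, eq_comm, smul_eq_zero] at this
    exact this.resolve_right hv0
  have hxw : φ x w = w := by rw [hx, hψ, one_smul]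
  have h2 := hadj.2 x w w
  rw [hxw] at h2
  have h3 := hd' w
  rw [hxw, hd0, zero_smul] at h3
  rw [← h2, h3, map_zero, LinearMap.zero_apply]

end AdjointForm

/-! ### Computing `gen` -/

section Gen

variable {K : Type*} [Field K] {B : Type*} [Ring B] [Algebra K B] {τ : B →ₗ[K] B}

theorem not_generates_empty (hτ : IsInvolution τ) [Nontrivial B] (h : Module.finrank K B ≠ 1) :
    ¬ Generates τ ∅ := by
  intro hgen
  have : (⊥ : Subalgebra K B) = ⊤ := by
    refine hgen ⊥ (Set.empty_subset _) fun x hx ↦ ?_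
    obtain ⟨c, rfl⟩ := Algebra.mem_bot.1 hx
    rw [Algebra.algebraMap_eq_smul_one, map_smul, hτ.map_one]
    exact Subalgebra.smul_mem _ (Subalgebra.one_mem _) _
  exact h (Subalgebra.bot_eq_top_iff_finrank_eq_one.1 this)

theorem gen_eq_one {x : B} (hx : Generates τ {x}) (h : ¬ Generates τ ∅) : gen τ = 1 := by
  refine le_antisymm ((iInf₂_le {x} hx).trans (by simp)) (le_iInf₂ fun S hS ↦ ?_)
  rw [Set.one_le_encard_iff_nonempty, Set.nonempty_iff_ne_empty]
  rintro rfl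
  exact h hS

theorem gen_eq_zero (h : Generates τ ∅) : gen τ = 0 :=
  le_antisymm ((iInf₂_le ∅ h).trans (by simp)) bot_le

theorem gen_eq_two {x : Fin 2 → B} (hx : Generates τ (Set.range x)) (h : ¬ Generates τ ∅)
    (h' : ∀ y, ¬ Generates τ {y}) : gen τ = 2 := by
  refine le_antisymm ((iInf₂_le _ hx).trans ?_) (le_iInf₂ fun S hS ↦ ?_)
  · rw [← Set.image_univ]
    refine (Set.encard_image_le _ _).trans ?_
    simp
  · by_contra! hlt
    have : S.encard ≤ 1 := ENat.lt_add_one_iff (by simp) |>.1 (by rwa [one_add_one_eq_two])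
    rcases Set.encard_le_one_iff_eq.1 this with rfl | ⟨y, rfl⟩
    · exact h hS
    · exact h' y hS

/-- A canonical involution stabilizes the subalgebra generated by any single element. -/
theorem IsCanonical.not_generates_singleton [Algebra.IsCentral K B] [Nontrivial B]
    (hc : IsCanonical τ) (h : Module.finrank K B ≠ 1) (x : B) :
    ¬ Generates τ {x} := by
  intro hgen
  have hxmem : x ∈ Algebra.adjoin K {x} := Algebra.self_mem_adjoin_singleton K x
  have htop : Algebra.adjoin K {x} = ⊤ := by
    refine hgen _ Algebra.subset_adjoin fun y hy ↦ ?_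
    obtain ⟨⟨c, hcy⟩, -⟩ := hc y
    rw [← eq_sub_iff_add_eq'] at hcy
    rw [hcy]
    exact Subalgebra.sub_mem _ (Subalgebra.algebraMap_mem _ c) hy
  -- Now `B = K[x]` is commutative, which centrality forbids unless `B = K`.
  have hx : x ∈ Subalgebra.center K B := Subalgebra.mem_center_iff.2 fun y ↦ by
    have hy : y ∈ Algebra.adjoin K {x} := htop ▸ Algebra.mem_top
    exact (Algebra.commute_of_mem_adjoin_singleton_of_commute hy (Commute.refl x)).symm
  have hle : Algebra.adjoin K {x} ≤ ⊥ := by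
    rw [← Algebra.IsCentral.center_eq_bot K B, Algebra.adjoin_le_iff, Set.singleton_subset_iff]
    exact hx
  rw [htop, top_le_iff] at hle
  exact h (Subalgebra.bot_eq_top_iff_finrank_eq_one.1 hle)

end Gen

end AlgInv

theorem mainTheorem7 {K : Type u} [Field K] {B : Type v} [Ring B] [Algebra K B]
    (τ : B →ₗ[K] B) (n : ℕ) (hτ : AlgInv.IsCentralSimple τ) (hn : AlgInv.HasDegree K B n) :
    (¬ (n = 2 ∧ AlgInv.IsSymplectic τ) → ¬ (n = 1 ∧ AlgInv.IsOrthogonal τ) → AlgInv.gen τ = 1) ∧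
    (n = 2 ∧ AlgInv.IsSymplectic τ → AlgInv.gen τ = 2) ∧
    (n = 1 ∧ AlgInv.IsOrthogonal τ → AlgInv.gen τ = 0) := by
  refine ⟨fun hs ho ↦ ?_, ?_, ?_⟩
  · rcases hτ with hτ | hτ
    · have := hτ.finiteDimensional
      have := hτ.simple
      have hfr := hτ.finrank_eq hn
      have hpos := Module.finrank_pos (R := K) (M := B)
      have h0 : n ≠ 0 := by rintro rfl; simp at hfr; omega
      have h1 : n ≠ 1 := by
        rintro rfl
        exact ho ⟨rfl, hτ, hτ.not_isSymplectic_of_degree_one hn⟩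
      have h2 : 2 ≤ n := by omega
      have hne : ¬ AlgInv.Generates τ ∅ := AlgInv.not_generates_empty hτ.involution (by
        rw [hfr]; nlinarith)
      rcases hτ.exists_generates_or_isCanonical hn h2 with ⟨x, hx⟩ | ⟨rfl, hc⟩
      · exact AlgInv.gen_eq_one hx hne
      · exact absurd ⟨rfl, hτ.isSymplectic_of_isCanonical hn hc⟩ hs
    · have := hτ.finiteDimensional
      obtain ⟨x, hx⟩ := hτ.exists_generates
      have hle : Module.finrank K (Subalgebra.center K B) ≤ Module.finrank K B :=
        Submodule.finrank_le (Subalgebra.toSubmodule (Subalgebra.center K B))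
      rw [hτ.finrank_center] at hle
      have : Nontrivial B := Module.nontrivial_of_finrank_pos (R := K) (by omega)
      exact AlgInv.gen_eq_one hx (AlgInv.not_generates_empty hτ.involution (by omega))
  · rintro ⟨rfl, hs⟩
    have := hs.1.simple
    have := hs.1.central
    have hfr := hs.1.finrank_eq hn
    obtain ⟨x, hx⟩ := hs.1.exists_pair_generates
    exact AlgInv.gen_eq_two hx (AlgInv.not_generates_empty hs.1.involution (by rw [hfr]; simp))
      ((hs.isCanonical hn).not_generates_singleton (by rw [hfr]; simp))
  · rintro ⟨rfl, ho⟩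
    have := ho.1.simple
    have hfr := ho.1.finrank_eq hn
    refine AlgInv.gen_eq_zero fun A _ _ ↦ ?_
    rw [eq_top_iff, ← Subalgebra.bot_eq_top_of_finrank_eq_one (by simpa using hfr)]
    exact bot_le
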